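/- **Setting.** Let $m,n$ be integers, $[m]=\{1,\dots,m\}$; for each $i\in[m]$ let $f_i:\mathbb{R}^n\to\mathbb{R}$ be continuously differentiable with $L_f$-Lipschitz gradient ($L_f>0$) and let $F_i:\mathbb{R}^n\to\mathbb{R}^n$ be $L_F$-Lipschitz. Suppose $f=\sum_i f_i$ is $\mu_f$-strongly convex ($\mu_f>0$), $F=\sum_i F_i$ is monotone, and $\mathrm{SOL}(\mathbb{R}^n,F)$ is nonempty, where $\mathrm{SOL}(X,G)=\{x\in X: G(x)^\top(y-x)\ge 0\ \forall y\in X\}$. Let $\mathbf R,\mathbf C\in\mathbb{R}^{m\times m}$ be nonnegative with positive diagonals, $\mathbf R\mathbf 1=\mathbf 1$, $\mathbf 1^\top\mathbf C=\mathbf 1^\top$. For a nonnegative matrix $\mathbf B$ let $\mathcal G_{\mathbf B}$ be the digraph on $[m]$ with an edge from $j$ to $i$ iff $B_{ij}>0$; suppose some vertex is the root of a directed spanning tree of $\mathcal G_{\mathbf R}$ and also the root of one of $\mathcal G_{\mathbf C^\top}$. Let $u,v\ge 0$ satisfy $u^\top\mathbf R=u^\top$, $u^\top\mathbf 1=m$,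 $\mathbf Cv=v$, $\mathbf 1^\top v=m$. Let $\|\cdot\|_{\mathbf R},\|\cdot\|_{\mathbf C}$ be arbitrary norms on $\mathbb{R}^m$. For a vector norm $\|\cdot\|$ on $\mathbb R^m$ and a matrix $W$ with $m$ rows, $\|W\|$ denotes the Euclidean norm of the vector of the norms $\|W_{\bullet j}\|$ of the columns (so $\|W\|_2$ is the Frobenius norm). Let $\delta>0$ satisfy $\|W\|_{\mathbf C}\le\delta\|W\|_2$ for all $W\in\mathbb{R}^{m\times n}$. Let $\hat\gamma,\lambda,\theta>0$, $\Gamma\ge 1$, $a>b>0$, $a+b<1$, $2a+3b<2$, and put $\hat\gamma_k=\hat\gamma/(k+\Gamma)^a$, $\lambda_k=\lambda/(k+\Gamma)^b$, $\Lambda_k=|1-\lambda_{k+1}/\lambda_k|$, $L_0=L_F+\lambda_0L_f$. Given stepsizes $\gamma_{i,k}\ge 0$ and initial points $x_{i,0}\in\mathbb{R}^n$, IR-Push-Pull sets $y_{i,0}=F_i(x_{i,0})+\lambda_0\nabla f_i(x_{i,0})$ and, for $k\ge 0$, $$x_{i,k+1}=\sum_{j}R_{ij}(x_{j,k}-\gamma_{j,k}y_{j,k}),$$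 $$y_{i,k+1}=\sum_jC_{ij}y_{j,k}+F_i(x_{i,k+1})+\lambda_{k+1}\nabla f_i(x_{i,k+1})-F_i(x_{i,k})-\lambda_k\nabla f_i(x_{i,k}).$$ Let $\mathbf x_k,\mathbf y_k\in\mathbb{R}^{m\times n}$ have rows $x_{i,k}^\top$, $y_{i,k}^\top$, and put $\bar x_k=\frac1mu^\top\mathbf x_k$, $\bar y_k=\frac1m\mathbf 1^\top\mathbf y_k$. Stepsizes are admissible if, for all $k\ge0$, $\gamma_{i,k}\ge0$, $\max_i\gamma_{i,k}=\hat\gamma_k$ and $\frac1m\sum_iu_i\gamma_{i,k}v_i\ge\theta\hat\gamma_k$. **Theorem.** The problem $\min\{f(x):x\in\mathrm{SOL}(\mathbb{R}^n,F)\}$ has a unique solution $x^*$; for each $k\ge 0$, $\mathrm{SOL}(\mathbb{R}^n,F+\lambda_k\nabla f)$ consists of exactly one point $x^*_{\lambda_k}$; and there are constants $M>0$, $B_F>0$, $K\ge 1$ with $$\|x^*_{\lambda_{k}}-x^*_{\lambda_{k-1}}\|_2\le\tfrac{M}{\mu_f}\Lambda_{k-1}\ (k\ge1),\qquad L_F\|\mathbf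 1x^*_{\lambda_k}-\mathbf 1x^*\|_2\le B_F\ (k\ge0),$$ which do not depend on the stepsizes $\gamma_{i,k}$ or on the initial points, such that for all admissible stepsizes and all initial points the following holds. Put $$c_0=\delta\|\mathbf I-\tfrac1mv\mathbf 1^\top\|_{\mathbf C},\qquad \sigma_{\mathbf R}=\|\mathbf R-\tfrac1m\mathbf 1u^\top\|_{\mathbf R},$$ $$\Theta=\max\Big\{1,\ \sigma_{\mathbf R}\hat\gamma L_0\|v\|_{\mathbf R},\ c_0L_0\big(\hat\gamma\|\mathbf R\|_2\|v\|_2L_0+\sqrt m\,\Lambda_0+\mu_fc_0B_F/M\big)\Big\}\frac{\sqrt3M}{\mu_f},$$ $$\|\Delta_1\|_2=\big(\|\bar x_1-x^*_{\lambda_0}\|_2^2+\|\mathbf x_1-\mathbf 1\bar x_1\|_{\mathbf R}^2+\|\mathbf y_1-v\bar y_1\|_{\mathbf C}^2\big)^{1/2},$$ $$\mathscr B=\max\Big\{K(\Gamma+1)^{1-a-b}\|\Delta_1\|_2,\ \frac{4\Theta}{\mu_f\lambda\hat\gamma\theta}\Big\}.$$ Then (i) $\|\mathbf x_{k+1}-\mathbf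 1\bar x_{k+1}\|_{\mathbf R}\le\dfrac{\mathscr B}{(k+\Gamma-1)^{1-a-b}}$ for all $k\ge1$; (ii) $\|\mathbf y_{k+1}-v\bar y_{k+1}\|_{\mathbf C}\le\dfrac{\mathscr B}{(k+\Gamma-1)^{1-a-b}}$ for all $k\ge1$; (iii) $\lim_{k\to\infty}\bar x_k=x^*$. -/

import Mathlib

noncomputable section

/-- Solution set of the variational inequality `VI(X, G)`. -/
def VISol {n : ℕ} (X : Set (EuclideanSpace ℝ (Fin n)))
    (G : EuclideanSpace ℝ (Fin n) → EuclideanSpace ℝ (Fin n)) :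
    Set (EuclideanSpace ℝ (Fin n)) :=
  {x | x ∈ X ∧ ∀ y ∈ X, 0 ≤ inner ℝ (G x) (y - x)}

/-- The global objective, the sum of the local objectives. -/
def sumObj {m n : ℕ} (f : Fin m → EuclideanSpace ℝ (Fin n) → ℝ)
    (x : EuclideanSpace ℝ (Fin n)) : ℝ :=
  ∑ i, f i x

/-- The global mapping, the sum of the local mappings. -/
def sumMap {m n : ℕ} (F : Fin m → EuclideanSpace ℝ (Fin n) → EuclideanSpace ℝ (Fin n))
    (x : EuclideanSpace ℝ (Fin n)) : EuclideanSpace ℝ (Fin n) :=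
  ∑ i, F i x

/-- Optimal equilibria: the minimizers of `∑ i, f i` over `SOL(ℝⁿ, ∑ i, F i)`. -/
def optimalNE {m n : ℕ} (f : Fin m → EuclideanSpace ℝ (Fin n) → ℝ)
    (F : Fin m → EuclideanSpace ℝ (Fin n) → EuclideanSpace ℝ (Fin n)) :
    Set (EuclideanSpace ℝ (Fin n)) :=
  {x | x ∈ VISol Set.univ (sumMap F) ∧ ∀ z ∈ VISol Set.univ (sumMap F), sumObj f x ≤ sumObj f z}

/-- A continuously differentiable function whose gradient is `μ`-strongly monotone. -/
structure IsStronglyConvexC1 {n : ℕ} (μ : ℝ) (g : EuclideanSpace ℝ (Fin n) → ℝ) : Prop where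
  contDiff : ContDiff ℝ 1 g
  mono : ∀ x y, μ * ‖x - y‖ ^ 2 ≤ inner ℝ (gradient g x - gradient g y) (x - y)

/-- A continuously differentiable function whose gradient is `L`-Lipschitz. -/
structure IsSmoothC1 {n : ℕ} (L : ℝ) (g : EuclideanSpace ℝ (Fin n) → ℝ) : Prop where
  contDiff : ContDiff ℝ 1 g
  lip : ∀ x y, ‖gradient g x - gradient g y‖ ≤ L * ‖x - y‖

/-- Assumptions on the objectives and the mappings. -/
structure ProblemAssumption {m n : ℕ} (f : Fin m → EuclideanSpace ℝ (Fin n) → ℝ)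
    (F : Fin m → EuclideanSpace ℝ (Fin n) → EuclideanSpace ℝ (Fin n)) (μf Lf LF : ℝ) : Prop where
  μf_pos : 0 < μf
  Lf_pos : 0 < Lf
  LF_nonneg : 0 ≤ LF
  strong : IsStronglyConvexC1 μf (sumObj f)
  smooth : ∀ i, IsSmoothC1 Lf (f i)
  mono : ∀ x y, 0 ≤ inner ℝ (sumMap F x - sumMap F y) (x - y)
  lip : ∀ i x y, ‖F i x - F i y‖ ≤ LF * ‖x - y‖

/-- The digraph induced by `B`: there is an edge from `j` to `i` iff `0 < B i j`. -/
def inducedDigraph {m : ℕ} (B : Matrix (Fin m) (Fin m) ℝ) : Digraph (Fin m) where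
  Adj j i := 0 < B i j

/-- `T` is the edge relation of a directed spanning tree of `G` with root `r`. -/
structure IsSpanningTree {V : Type*} (G : Digraph V) (r : V) (T : V → V → Prop) : Prop where
  sub : ∀ i j, T i j → G.Adj i j
  root : ∀ i, ¬ T i r
  parent : ∀ j, j ≠ r → ∃! i, T i j
  reach : ∀ j, Relation.ReflTransGen T r j

/-- The set of the roots of all spanning trees of the digraph induced by `B`. -/
def treeRoots {m : ℕ} (B : Matrix (Fin m) (Fin m) ℝ) : Set (Fin m) :=
  {r | ∃ T, IsSpanningTree (inducedDigraph B) r T}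

/-- Assumptions on the mixing matrices. -/
structure MixingAssumption {m : ℕ} (R C : Matrix (Fin m) (Fin m) ℝ) : Prop where
  R_nonneg : ∀ i j, 0 ≤ R i j
  R_diag : ∀ i, 0 < R i i
  R_row : ∀ i, ∑ j, R i j = 1
  C_nonneg : ∀ i j, 0 ≤ C i j
  C_diag : ∀ i, 0 < C i i
  C_col : ∀ j, ∑ i, C i j = 1
  roots : (treeRoots R ∩ treeRoots C.transpose).Nonempty

/-- The sequence `c / (k + Γ) ^ p`. -/
def decay (c Γ p : ℝ) (k : ℕ) : ℝ := c / ((k : ℝ) + Γ) ^ p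

/-- Algorithm IR-Push-Pull: the pair `(x_k, y_k)` of the families of local iterates. -/
def irPushPull {m n : ℕ} (f : Fin m → EuclideanSpace ℝ (Fin n) → ℝ)
    (F : Fin m → EuclideanSpace ℝ (Fin n) → EuclideanSpace ℝ (Fin n))
    (R C : Matrix (Fin m) (Fin m) ℝ) (lamk : ℕ → ℝ) (γ : ℕ → Fin m → ℝ)
    (x0 : Fin m → EuclideanSpace ℝ (Fin n)) :
    ℕ → (Fin m → EuclideanSpace ℝ (Fin n)) × (Fin m → EuclideanSpace ℝ (Fin n))
  | 0 => (x0, fun i => F i (x0 i) + lamk 0 • gradient (f i) (x0 i))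
  | k + 1 =>
    let x := (irPushPull f F R C lamk γ x0 k).1
    let y := (irPushPull f F R C lamk γ x0 k).2
    let x' : Fin m → EuclideanSpace ℝ (Fin n) := fun i => ∑ j, R i j • (x j - γ k j • y j)
    (x', fun i => ∑ j, C i j • y j + F i (x' i) + lamk (k + 1) • gradient (f i) (x' i)
      - F i (x i) - lamk k • gradient (f i) (x i))

/-- The weighted average `(1/m) ∑ i, w i • x i`. -/
def wavg {m n : ℕ} (w : Fin m → ℝ) (x : Fin m → EuclideanSpace ℝ (Fin n)) :
    EuclideanSpace ℝ (Fin n) :=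
  (1 / (m : ℝ)) • ∑ i, w i • x i

/-- The Euclidean norm of a vector of `ℝᵐ`. -/
def l2 {m : ℕ} (w : Fin m → ℝ) : ℝ := √(∑ i, w i ^ 2)

/-- The matrix norm induced by a vector norm `N`: the Euclidean norm of the vector of the
`N`-norms of the columns. -/
def colNorm {m p : ℕ} (N : (Fin m → ℝ) → ℝ) (W : Matrix (Fin m) (Fin p) ℝ) : ℝ :=
  √(∑ j, N (fun i => W i j) ^ 2)

/-- The `m × n` matrix whose rows are the given vectors. -/
def rowsMat {m n : ℕ} (x : Fin m → EuclideanSpace ℝ (Fin n)) : Matrix (Fin m) (Fin n) ℝ :=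
  Matrix.of fun i j => x i j

/-- The consensus error of `x`: the norm of `x - 1 x̄`, where `x̄ = (1/m) uᵀ x`. -/
def errX {m n : ℕ} (N : (Fin m → ℝ) → ℝ) (u : Fin m → ℝ)
    (x : Fin m → EuclideanSpace ℝ (Fin n)) : ℝ :=
  colNorm N (rowsMat fun i => x i - wavg u x)

/-- The consensus error of `y`: the norm of `y - v ȳ`, where `ȳ = (1/m) 1ᵀ y`. -/
def errY {m n : ℕ} (N : (Fin m → ℝ) → ℝ) (v : Fin m → ℝ)
    (y : Fin m → EuclideanSpace ℝ (Fin n)) : ℝ :=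
  colNorm N (rowsMat fun i => y i - v i • wavg (fun _ => 1) y)

/-- `Λ_k = |1 - λ_{k+1} / λ_k|`. -/
def relDecr (lamk : ℕ → ℝ) (k : ℕ) : ℝ := |1 - lamk (k + 1) / lamk k|

/-- `σ_R`, the norm of `R - 1 uᵀ / m`. -/
def sigmaR {m : ℕ} (R : Matrix (Fin m) (Fin m) ℝ) (u : Fin m → ℝ) (NR : (Fin m → ℝ) → ℝ) : ℝ :=
  colNorm NR (Matrix.of fun i j => R i j - u j / (m : ℝ))

/-- `c₀ = δ ‖I - v 1ᵀ / m‖_C`. -/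
def cZero {m : ℕ} (v : Fin m → ℝ) (NC : (Fin m → ℝ) → ℝ) (δ : ℝ) : ℝ :=
  δ * colNorm NC (Matrix.of fun i j => (1 : Matrix (Fin m) (Fin m) ℝ) i j - v i / (m : ℝ))

/-- The constant `Θ` of the error bound; `L0 = L_F + λ_0 L_f`. -/
def Theta {m : ℕ} (R : Matrix (Fin m) (Fin m) ℝ) (u v : Fin m → ℝ) (NR NC : (Fin m → ℝ) → ℝ)
    (μf L0 gam δ M BF : ℝ) (lamk : ℕ → ℝ) : ℝ :=
  max (max 1 (sigmaR R u NR * gam * L0 * NR v))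
    (cZero v NC δ * L0 * (gam * colNorm l2 R * l2 v * L0 + √(m : ℝ) * relDecr lamk 0
      + μf * cZero v NC δ * BF / M))
    * (√3 * M / μf)

/-- Admissible stepsizes: nonnegative, with largest entry `gamk k` at step `k`, and with
`α_k = (1/m) uᵀ diag(γ_k) v ≥ θ gamk k`. -/
structure IsStepsize {m : ℕ} (u v : Fin m → ℝ) (gamk : ℕ → ℝ) (θ : ℝ)
    (γ : ℕ → Fin m → ℝ) : Prop where
  nonneg : ∀ k i, 0 ≤ γ k i
  isMax : ∀ k, IsGreatest (Set.range (γ k)) (gamk k)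
  lower : ∀ k, θ * gamk k ≤ (1 / (m : ℝ)) * ∑ i, u i * γ k i * v i

end

open Filter Topology

/-! The averaged iterate chases a moving target. Each regularized map `F + λ_k ∇f` is strongly
monotone with modulus `λ_k μ_f`, so it has exactly one zero. As `λ_k → 0` these zeros converge to
the minimizer of `f` over the zeros of `F` (`exists_tendsto_of_regularized_zeros`), and consecutive
zeros differ by `O(Λ_k) = O(1/k)` (`norm_sub_le_of_regularized_zeros`).

The trackers always sum to the current local maps, so the average makes a perturbed gradient step.
That step contracts towards the current zero by a factor `1 - const · k^(-(a+b))`, up to a term of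
order `k^(-2a)` (`norm_wavg_step_sub_le`). Meanwhile both consensus deviations contract
geometrically. The prescribed norms need not see this contraction, so the analysis runs in adapted
norms, built from the decay of the powers of `R - 1uᵀ/m` and `C - v1ᵀ/m`, and returns by equivalence
of norms.

Drift `1/k` against contraction `k^(-(a+b))` leaves an error of order `k^(-(1-a-b))`. In
`exists_rate_of_coupled_recursion` the constant is fixed before the sequences and the bound is
affine in the initial errors, hence uniform in stepsizes and initial points (`exists_uniform_rate`).

The stated form follows because `M` and `K` are free to be large: `Θ ≥ √3 M / μ_f`, so one branch of
the maximum absorbs the constant part of the bound and the other the part proportional to `‖Δ₁‖`. -/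

/-- The test point `x - G x` turns the inequality into `-‖G x‖² ≥ 0`, so every variational
inequality below becomes an equation. -/
lemma mem_VISol_univ {n : ℕ} {G : EuclideanSpace ℝ (Fin n) → EuclideanSpace ℝ (Fin n)}
    {x : EuclideanSpace ℝ (Fin n)} : x ∈ VISol Set.univ G ↔ G x = 0 := by
  constructor
  · rintro ⟨-, h⟩
    have h1 := h (x - G x) (Set.mem_univ _)
    rw [sub_sub_cancel_left, inner_neg_right, real_inner_self_eq_norm_sq] at h1
    have h2 : ‖G x‖ ^ 2 = 0 := le_antisymm (by linarith) (sq_nonneg _)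
    simpa using h2
  · intro h
    exact ⟨Set.mem_univ _, fun y _ => by simp [h]⟩

/-! ### Strongly monotone maps and Tikhonov regularization. -/

section InnerProduct

variable {E : Type*} [NormedAddCommGroup E] [InnerProductSpace ℝ E]

/-- A gradient-like step contracts, up to a term of second order in the stepsize. -/
lemma norm_sub_smul_le_of_strongly_monotone {d g : E} {c L t : ℝ} (hc : 0 ≤ c) (hcL : c ≤ L)
    (ht : 0 ≤ t) (hmono : c * ‖d‖ ^ 2 ≤ inner ℝ g d) (hlip : ‖g‖ ≤ L * ‖d‖) :
    ‖d - t • g‖ ≤ (1 - t * c + (t * L) ^ 2 / 2) * ‖d‖ := by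
  have hL : 0 ≤ L := hc.trans hcL
  have htL : 0 ≤ t * L := mul_nonneg ht hL
  have htc : t * c ≤ t * L := mul_le_mul_of_nonneg_left hcL ht
  have hpos : 0 ≤ 1 - t * c + (t * L) ^ 2 / 2 := by nlinarith [sq_nonneg (t * L - 1)]
  refine abs_le_of_sq_le_sq' ?_ (by positivity) |>.2
  have h1 : ‖d - t • g‖ ^ 2 = ‖d‖ ^ 2 - 2 * (t * inner ℝ g d) + t ^ 2 * ‖g‖ ^ 2 := by
    rw [norm_sub_sq_real, inner_smul_right, norm_smul, real_inner_comm, mul_pow,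
      Real.norm_eq_abs, sq_abs]
  have h2 : ‖g‖ ^ 2 ≤ L ^ 2 * ‖d‖ ^ 2 := by
    rw [← mul_pow]; exact pow_le_pow_left₀ (norm_nonneg _) hlip 2
  have h3 : t * (c * ‖d‖ ^ 2) ≤ t * inner ℝ g d := mul_le_mul_of_nonneg_left hmono ht
  have h4 : t ^ 2 * ‖g‖ ^ 2 ≤ t ^ 2 * (L ^ 2 * ‖d‖ ^ 2) :=
    mul_le_mul_of_nonneg_left h2 (sq_nonneg t)
  rw [h1]
  -- This square, times `‖d‖²`, is exactly the excess of the squared claimed bound over `(1 - 2tc +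
  -- (tL)²) ‖d‖²`.
  have h5 : 0 ≤ (t * c - (t * L) ^ 2 / 2) ^ 2 * ‖d‖ ^ 2 := by positivity
  nlinarith

/-- Banach's fixed point theorem for `x ↦ x - t • G x`. -/
lemma exists_zero_of_strongly_monotone [CompleteSpace E] {G : E → E} {c L : ℝ} (hc : 0 < c)
    (hmono : ∀ x y, c * ‖x - y‖ ^ 2 ≤ inner ℝ (G x - G y) (x - y))
    (hlip : ∀ x y, ‖G x - G y‖ ≤ L * ‖x - y‖) : ∃ x, G x = 0 := by
  obtain ⟨L', hcL, hLL⟩ : ∃ L', c ≤ L' ∧ L ≤ L' := ⟨max c L, le_max_left _ _, le_max_right _ _⟩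
  have hL' : 0 < L' := hc.trans_le hcL
  -- The minimizer of `1 - t c + (t L')² / 2`; the resulting factor `1 - c² / (2 L'²)` lies in `[0,
  -- 1)` because `c ≤ L'`.
  set t := c / L' ^ 2 with ht
  have htpos : 0 < t := by positivity
  set κ := 1 - t * c + (t * L') ^ 2 / 2 with hκ
  have hκ' : κ = 1 - c ^ 2 / L' ^ 2 / 2 := by rw [hκ, ht]; field_simp; ring
  have h1 : c ^ 2 / L' ^ 2 ≤ 1 := by
    rw [div_le_one (by positivity)]; exact pow_le_pow_left₀ hc.le hcL 2
  have h2 : 0 < c ^ 2 / L' ^ 2 := by positivity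
  have hκ0 : 0 ≤ κ := by rw [hκ']; linarith
  have hκ1 : κ < 1 := by rw [hκ']; linarith
  have hcon : ContractingWith ⟨κ, hκ0⟩ (fun x => x - t • G x) := by
    refine ⟨by exact_mod_cast hκ1, LipschitzWith.of_dist_le_mul fun x y => ?_⟩
    rw [dist_eq_norm, dist_eq_norm]
    have : x - t • G x - (y - t • G y) = (x - y) - t • (G x - G y) := by
      rw [smul_sub]; abel
    rw [this]
    exact norm_sub_smul_le_of_strongly_monotone hc.le hcL htpos.le (hmono x y)
      ((hlip x y).trans (mul_le_mul_of_nonneg_right hLL (norm_nonneg _)))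
  have hfix := hcon.fixedPoint_isFixedPt
  refine ⟨ContractingWith.fixedPoint _ hcon, ?_⟩
  have h3 := hfix.eq
  simp only [sub_eq_self, smul_eq_zero, htpos.ne', false_or] at h3
  exact h3

lemma eq_of_strongly_monotone_of_eq_zero {G : E → E} {c : ℝ} (hc : 0 < c)
    (hmono : ∀ x y, c * ‖x - y‖ ^ 2 ≤ inner ℝ (G x - G y) (x - y)) {x y : E}
    (hx : G x = 0) (hy : G y = 0) : x = y := by
  have h := hmono x y
  rw [hx, hy, sub_zero, inner_zero_left] at h
  have : ‖x - y‖ ^ 2 = 0 := le_antisymm (by nlinarith [sq_nonneg ‖x - y‖]) (sq_nonneg _)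
  rw [← sub_eq_zero]; simpa using this

/-- The first-order characterization of strong convexity. -/
lemma add_inner_gradient_add_le [CompleteSpace E] {g : E → ℝ} {μ : ℝ} (hg : Differentiable ℝ g)
    (hmono : ∀ x y, μ * ‖x - y‖ ^ 2 ≤ inner ℝ (gradient g x - gradient g y) (x - y)) (p z : E) :
    g p + inner ℝ (gradient g p) (z - p) + μ / 2 * ‖z - p‖ ^ 2 ≤ g z := by
  set w := z - p with hw
  -- Along the segment, `g` minus its tangent and minus the quadratic term. Strong monotonicity
  -- between `p + t • w` and `p` is `t` times the statement that the derivative of `φ` is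
  -- nonnegative.
  let φ : ℝ → ℝ := fun t => g (p + t • w) - t * inner ℝ (gradient g p) w - μ / 2 * ‖w‖ ^ 2 * t ^ 2
  have hφ : ∀ t, HasDerivAt φ (inner ℝ (gradient g (p + t • w)) w - inner ℝ (gradient g p) w
      - μ * ‖w‖ ^ 2 * t) t := by
    intro t
    have h1 : HasDerivAt (fun t : ℝ => p + t • w) w t := by
      simpa using ((hasDerivAt_id t).smul_const w).const_add p
    have h2 : HasDerivAt (fun t : ℝ => g (p + t • w)) (inner ℝ (gradient g (p + t • w)) w) t := by
      have h3 := (hg (p + t • w)).hasGradientAt.hasFDerivAt.comp_hasDerivAt t h1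
      exact h3.congr_deriv (by simp)
    have h4 := ((hasDerivAt_id t).mul_const (inner ℝ (gradient g p) w))
    have h5 := ((hasDerivAt_id t).pow 2).const_mul (μ / 2 * ‖w‖ ^ 2)
    refine ((h2.sub h4).sub h5).congr_deriv ?_
    simp; ring
  have hmonoφ : MonotoneOn φ (Set.Icc 0 1) := by
    refine monotoneOn_of_deriv_nonneg (convex_Icc 0 1)
      (fun t _ => (hφ t).continuousAt.continuousWithinAt)
      (fun t _ => (hφ t).differentiableAt.differentiableWithinAt) fun t ht => ?_
    rw [interior_Icc] at ht
    rw [(hφ t).deriv]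
    have h := hmono (p + t • w) p
    rw [add_sub_cancel_left, inner_smul_right, norm_smul, mul_pow, Real.norm_eq_abs, sq_abs,
      inner_sub_left] at h
    have ht0 := ht.1
    by_contra hcon
    push Not at hcon
    have := mul_neg_of_pos_of_neg ht0 hcon
    nlinarith
  have h := hmonoφ (by simp) (by simp) (zero_le_one' ℝ)
  simp only [φ, zero_smul, add_zero, one_smul, hw, add_sub_cancel] at h
  rw [← hw] at h
  nlinarith

/-- Tikhonov trajectories stay close to every zero of the monotone map. -/
lemma norm_sub_le_of_regularized_zero {Φ G : E → E} {μ l : ℝ} (hμ : 0 < μ) (hl : 0 < l)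
    (hΦ : ∀ x y, 0 ≤ inner ℝ (Φ x - Φ y) (x - y))
    (hG : ∀ x y, μ * ‖x - y‖ ^ 2 ≤ inner ℝ (G x - G y) (x - y)) {x z : E}
    (hx : Φ x + l • G x = 0) (hz : Φ z = 0) :
    inner ℝ (G x) (x - z) ≤ 0 ∧ ‖x - z‖ ≤ ‖G z‖ / μ := by
  have h1 : inner ℝ (G x) (x - z) ≤ 0 := by
    have h := hΦ x z
    rw [hz, sub_zero, eq_neg_of_add_eq_zero_left hx, inner_neg_left, real_inner_smul_left] at h
    by_contra hc
    push Not at hc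
    nlinarith [mul_pos hl hc]
  refine ⟨h1, ?_⟩
  rw [le_div_iff₀ hμ]
  have h2 := hG x z
  rw [inner_sub_left] at h2
  have h3 := abs_le.1 (abs_real_inner_le_norm (G z) (x - z)) |>.1
  rcases (norm_nonneg (x - z)).eq_or_lt' with h0 | h0
  · rw [h0]; simp
  · refine le_of_mul_le_mul_right ?_ h0
    nlinarith

/-- Two points of a Tikhonov trajectory. -/
lemma norm_sub_le_of_regularized_zeros {Φ G : E → E} {μ l l' : ℝ} (hμ : 0 < μ) (hl : 0 < l)
    (hΦ : ∀ x y, 0 ≤ inner ℝ (Φ x - Φ y) (x - y))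
    (hG : ∀ x y, μ * ‖x - y‖ ^ 2 ≤ inner ℝ (G x - G y) (x - y)) {x y : E}
    (hx : Φ x + l • G x = 0) (hy : Φ y + l' • G y = 0) :
    ‖y - x‖ ≤ ‖G y‖ / μ * |1 - l' / l| := by
  rw [div_mul_eq_mul_div, le_div_iff₀ hμ]
  have h := hΦ x y
  rw [eq_neg_of_add_eq_zero_left hx, eq_neg_of_add_eq_zero_left hy] at h
  -- Pivoting on `G y` separates a part controlled by strong monotonicity from a part proportional
  -- to `l - l'`.
  have h1 : -(l • G x) - -(l' • G y) = -(l • (G x - G y)) - (l - l') • G y := by module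
  rw [h1, inner_sub_left, inner_neg_left, real_inner_smul_left, real_inner_smul_left] at h
  have h2 := hG x y
  have h3 : -((l - l') * inner ℝ (G y) (x - y)) ≤ |l - l'| * (‖G y‖ * ‖x - y‖) := by
    refine (neg_le_abs _).trans ?_
    rw [abs_mul]
    exact mul_le_mul_of_nonneg_left (abs_real_inner_le_norm _ _) (abs_nonneg _)
  have h4 : |l - l'| = l * |1 - l' / l| := by
    rw [← abs_of_pos hl, ← abs_mul, abs_of_pos hl]
    congr 1; field_simp
  rw [norm_sub_rev y x]
  rcases (norm_nonneg (x - y)).eq_or_lt' with h0 | h0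
  · rw [h0, zero_mul]; positivity
  · refine le_of_mul_le_mul_right ?_ (mul_pos hl h0)
    rw [h4] at h3
    nlinarith [mul_le_mul_of_nonneg_left h2 hl.le]

/-- Tikhonov trajectories converge to the minimizer over the zeros of the monotone map. -/
lemma exists_tendsto_of_regularized_zeros [CompleteSpace E] [ProperSpace E] {Φ : E → E} {g : E → ℝ}
    {μ : ℝ} {l : ℕ → ℝ} {x : ℕ → E} (hμ : 0 < μ) (hl : ∀ k, 0 < l k)
    (hl0 : Filter.Tendsto l Filter.atTop (nhds 0))
    (hΦ : ∀ x y, 0 ≤ inner ℝ (Φ x - Φ y) (x - y)) (hΦc : Continuous Φ)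
    (hg : Differentiable ℝ g) (hgc : Continuous (gradient g))
    (hmono : ∀ x y, μ * ‖x - y‖ ^ 2 ≤ inner ℝ (gradient g x - gradient g y) (x - y))
    (hne : ∃ z, Φ z = 0) (hx : ∀ k, Φ (x k) + l k • gradient g (x k) = 0) :
    ∃ p, {z | Φ z = 0 ∧ ∀ w, Φ w = 0 → g z ≤ g w} = {p} ∧
      Filter.Tendsto x Filter.atTop (nhds p) := by
  obtain ⟨z₀, hz₀⟩ := hne
  have hbd : ∀ k, x k ∈ Metric.closedBall z₀ (‖gradient g z₀‖ / μ) := fun k => by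
    rw [mem_closedBall_iff_norm]
    exact (norm_sub_le_of_regularized_zero hμ (hl k) hΦ hmono (hx k) hz₀).2
  -- Every cluster point is a zero of `Φ` and solves the first-order condition for minimizing `g`
  -- over the zeros.
  have hclus : ∀ (ψ : ℕ → ℕ) (q : E), Filter.Tendsto ψ Filter.atTop Filter.atTop →
      Filter.Tendsto (fun k => x (ψ k)) Filter.atTop (nhds q) →
      Φ q = 0 ∧ ∀ w, Φ w = 0 → inner ℝ (gradient g q) (q - w) ≤ 0 := by
    intro ψ q hψ hq
    have hgq := (hgc.tendsto q).comp hq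
    have hlψ := hl0.comp hψ
    constructor
    · have h1 := (hlψ.smul hgq).neg
      rw [zero_smul, neg_zero] at h1
      have h2 := (hΦc.tendsto q).comp hq
      refine tendsto_nhds_unique h2 (h1.congr fun k => ?_)
      exact (eq_neg_of_add_eq_zero_left (hx (ψ k))).symm
    · intro w hw
      refine le_of_tendsto (hgq.inner (hq.sub_const w)) (Filter.Eventually.of_forall fun k => ?_)
      exact (norm_sub_le_of_regularized_zero hμ (hl _) hΦ hmono (hx (ψ k)) hw).1
  obtain ⟨p, -, ψ, hψ, hp⟩ := (isCompact_closedBall z₀ (‖gradient g z₀‖ / μ)).tendsto_subseq hbd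
  obtain ⟨hp0, hp1⟩ := hclus ψ p hψ.tendsto_atTop hp
  -- Quadratic growth at `p` gives both minimality and uniqueness.
  have hlow : ∀ w, Φ w = 0 → g p + μ / 2 * ‖w - p‖ ^ 2 ≤ g w := fun w hw => by
    have h1 := add_inner_gradient_add_le hg hmono p w
    have h2 := hp1 w hw
    rw [← neg_sub w p, inner_neg_right] at h2
    linarith
  refine ⟨p, ?_, ?_⟩
  · refine Set.eq_singleton_iff_unique_mem.2 ⟨⟨hp0, fun w hw => ?_⟩, ?_⟩
    · have := hlow w hw
      nlinarith [sq_nonneg ‖w - p‖]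
    · rintro w ⟨hw, hw'⟩
      have h1 := hlow w hw
      have h2 := hw' p hp0
      have h3 : ‖w - p‖ ^ 2 = 0 := le_antisymm (by nlinarith) (sq_nonneg _)
      rw [← sub_eq_zero]; simpa using h3
  · refine Filter.tendsto_of_subseq_tendsto fun ns hns => ?_
    obtain ⟨q, -, φ, hφ, hq⟩ :=
      (isCompact_closedBall z₀ (‖gradient g z₀‖ / μ)).tendsto_subseq fun k => hbd (ns k)
    obtain ⟨hq0, hq1⟩ := hclus (ns ∘ φ) q (hns.comp hφ.tendsto_atTop) hq
    refine ⟨φ, ?_⟩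
    -- The first-order conditions at `p` and at `q`, tested against each other, contradict strong
    -- monotonicity unless `q = p`.
    have h1 := hmono q p
    have h2 := hq1 p hp0
    have h3 := hp1 q hq0
    rw [← neg_sub q p, inner_neg_right] at h3
    rw [inner_sub_left] at h1
    have h4 : ‖q - p‖ ^ 2 = 0 := le_antisymm (by nlinarith) (sq_nonneg _)
    have h5 : q = p := by rw [← sub_eq_zero]; simpa using h4
    rw [← h5]; exact hq

end InnerProduct

lemma gradient_sumObj {m n : ℕ} {f : Fin m → EuclideanSpace ℝ (Fin n) → ℝ}
    (hf : ∀ i, Differentiable ℝ (f i)) (x : EuclideanSpace ℝ (Fin n)) :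
    gradient (sumObj f) x = ∑ i, gradient (f i) x := by
  have : sumObj f = fun x => ∑ i, f i x := rfl
  rw [this]
  unfold gradient
  rw [fderiv_fun_sum fun i _ => hf i x, map_sum]

/-! ### Scalar recursions with power-law coefficients. -/

/-- Comparison sequences `s ^ (-p)` with `p ≤ 1` lose at most a factor `1 - 1/s` per step, so an
induction step only has to gain that factor. -/
lemma one_sub_inv_mul_rpow_le {s p : ℝ} (hs : 1 ≤ s) (hp : p ≤ 1) :
    (1 - s⁻¹) * s ^ (-p) ≤ (s + 1) ^ (-p) := by
  have hs0 : 0 < s := by linarith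
  have h1 : s + 1 = s * ((s + 1) / s) := by field_simp
  have h2 : 1 ≤ (s + 1) / s := by rw [le_div_iff₀ hs0]; linarith
  rw [h1, Real.mul_rpow hs0.le (by linarith), mul_comm]
  refine mul_le_mul_of_nonneg_left ?_ (by positivity)
  calc 1 - s⁻¹ ≤ ((s + 1) / s) ^ (-1 : ℝ) := by
        rw [Real.rpow_neg_one, inv_div, le_div_iff₀ (by linarith)]
        field_simp
        nlinarith
    _ ≤ _ := Real.rpow_le_rpow_of_exponent_le h2 (by linarith)

lemma tendsto_natCast_add_rpow_neg (Γ : ℝ) {p : ℝ} (hp : 0 < p) :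
    Tendsto (fun k : ℕ => ((k : ℝ) + Γ) ^ (-p)) atTop (𝓝 0) :=
  (tendsto_rpow_neg_atTop hp).comp
    (tendsto_atTop_add_const_right _ _ tendsto_natCast_atTop_atTop)

/-- A crude growth bound for the finitely many early steps, where the coefficients are not yet
small. -/
lemma coupled_step_growth {ρ c c₀ P U I W Z W' Z' : ℝ} (hρ : ρ < 1) (hc : 0 < c) (hc₀ : 0 < c₀)
    (hP0 : 0 ≤ P) (hP : P ≤ 1) (hU : 0 ≤ U) (hI : I ≤ 1) (hW : 0 ≤ W) (hZ : 0 ≤ Z)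
    (h1 : W' ≤ ρ * W + c * P * (Z + W) + c * I)
    (h2 : Z' ≤ (1 - c₀ * U + c * P ^ 2) * Z + c * I + c * P * W) :
    1 + Z' + W' ≤ (3 + 4 * c) * (1 + Z + W) := by
  have e0 : c * P ≤ c := by nlinarith
  have e1 : ρ * W ≤ W := by nlinarith
  have e2 : c * P * (Z + W) ≤ c * (Z + W) := mul_le_mul_of_nonneg_right e0 (by linarith)
  have e3 : c * I ≤ c := by nlinarith
  have e4 : c * P * W ≤ c * W := mul_le_mul_of_nonneg_right e0 hW
  have e5 : (1 - c₀ * U + c * P ^ 2) * Z ≤ (1 + c) * Z := by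
    refine mul_le_mul_of_nonneg_right ?_ hZ
    have h3 : P ^ 2 ≤ 1 := pow_le_one₀ hP0 hP
    have h4 : c * P ^ 2 ≤ c := by nlinarith
    linarith [mul_nonneg hc₀.le hU]
  linarith [mul_nonneg hc.le hW, mul_nonneg hc.le hZ]

/-- The contraction `c₀ U` is spent in quarters: one on the source `c I`, one on `c P²` together
with the feedback of `W`, one on the factor `1 - I` lost by the comparison sequence. -/
lemma coupled_step_slow {c c₀ D B P Q U I W Z Z' : ℝ} (hc : 0 < c) (hB : 0 < B) (hP0 : 0 < P)
    (hQ0 : 0 < Q) (hU : 0 < U) (hI : I = U * Q) (hBc : c ≤ B * (c₀ / 4))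
    (g3 : c * (1 + D) * P ^ 2 ≤ c₀ / 4 * U) (g4 : I ≤ c₀ / 4 * U) (g5 : c₀ * U ≤ 1)
    (hw : W ≤ B * D * (P * Q)) (hz : Z ≤ B * Q)
    (h2 : Z' ≤ (1 - c₀ * U + c * P ^ 2) * Z + c * I + c * P * W) :
    Z' ≤ B * ((1 - I) * Q) := by
  have e1 : (1 - c₀ * U + c * P ^ 2) * Z ≤ (1 - c₀ * U + c * P ^ 2) * (B * Q) :=
    mul_le_mul_of_nonneg_left hz (by linarith [mul_nonneg hc.le (sq_nonneg P)])
  have e2 : c * P * W ≤ c * P * (B * D * (P * Q)) :=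
    mul_le_mul_of_nonneg_left hw (by positivity)
  have e3 : c * I ≤ c₀ / 4 * U * (B * Q) := by
    rw [hI]
    have : c * (U * Q) ≤ B * (c₀ / 4) * (U * Q) :=
      mul_le_mul_of_nonneg_right hBc (by positivity)
    linarith
  have e4 : (1 - c₀ * U + c * P ^ 2 + c₀ / 4 * U + c * D * P ^ 2) * (B * Q)
      ≤ (1 - I) * (B * Q) :=
    mul_le_mul_of_nonneg_right (by nlinarith) (by positivity)
  linarith

/-- The gap `(1 - ρ) D = 4 c` pays `2 c` for the drive by `Z` and the source; the remaining half
pays for the self-coupling `c P` and the loss `I`. -/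
lemma coupled_step_fast {ρ c D B P Q I W Z W' : ℝ} (hρ0 : 0 ≤ ρ) (hc : 0 < c) (hD : 0 < D)
    (hDρ : D * (1 - ρ) = 4 * c) (hB1 : 1 ≤ B) (hP0 : 0 < P) (hQ0 : 0 < Q) (hI : I ≤ P * Q)
    (g1 : c * P ≤ (1 - ρ) / 4) (g2 : I ≤ (1 - ρ) / 4)
    (hw : W ≤ B * D * (P * Q)) (hz : Z ≤ B * Q)
    (h1 : W' ≤ ρ * W + c * P * (Z + W) + c * I) :
    W' ≤ B * D * ((1 - I) * (P * Q)) := by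
  have e1 : c * P * (Z + W) ≤ c * P * (B * Q + B * D * (P * Q)) :=
    mul_le_mul_of_nonneg_left (by linarith) (by positivity)
  have e2 : ρ * W ≤ ρ * (B * D * (P * Q)) := mul_le_mul_of_nonneg_left hw hρ0
  have e3 : c * I ≤ c * (B * (P * Q)) := by
    refine mul_le_mul_of_nonneg_left ?_ hc.le
    have h4 : 0 < P * Q := by positivity
    nlinarith
  have e4 : (ρ * D + c + c * P * D + c) * (B * (P * Q)) ≤ (1 - I) * D * (B * (P * Q)) := by
    refine mul_le_mul_of_nonneg_right ?_ (by positivity)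
    have h5 : (c * P + I) * D ≤ (1 - ρ) / 2 * D :=
      mul_le_mul_of_nonneg_right (by linarith) hD.le
    linarith
  linarith

/-- Coupled recursions: a contraction `W` driven by `Z`, and a slow contraction `Z` driven by `W`;
the ratio of the perturbation to the contraction rate of `Z` is of order `s ^ (-(1 - a - b))`. -/
lemma exists_rate_of_coupled_recursion {a b ρ c c₀ Γ : ℝ} (hb : 0 < b) (hba : b < a)
    (hab : a + b < 1) (hρ0 : 0 ≤ ρ) (hρ : ρ < 1) (hc : 0 < c) (hc₀ : 0 < c₀) (hΓ : 1 ≤ Γ) :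
    ∃ K : ℝ, 0 < K ∧ ∀ W Z : ℕ → ℝ, (∀ k, 0 ≤ W k) → (∀ k, 0 ≤ Z k) →
      (∀ k : ℕ, W (k + 1) ≤ ρ * W k + c * ((k : ℝ) + Γ) ^ (-a) * (Z k + W k)
        + c * ((k : ℝ) + Γ)⁻¹) →
      (∀ k : ℕ, Z (k + 1) ≤ (1 - c₀ * ((k : ℝ) + Γ) ^ (-(a + b)) + c * (((k : ℝ) + Γ) ^ (-a)) ^ 2) * Z k
        + c * ((k : ℝ) + Γ)⁻¹ + c * ((k : ℝ) + Γ) ^ (-a) * W k) →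
      ∀ k : ℕ, W k ≤ K * (1 + Z 0 + W 0) * ((k : ℝ) + Γ) ^ (-(1 - a - b)) ∧
        Z k ≤ K * (1 + Z 0 + W 0) * ((k : ℝ) + Γ) ^ (-(1 - a - b)) := by
  set r := 1 - a - b with hr
  have hr0 : 0 < r := by linarith
  -- `W` follows its drive `c P Z` with gain of order `1 / (1 - ρ)`, so the ansatz is `Z ≤ B Q`, `W
  -- ≤ B D P Q` with `P = s ^ (-a)`, `Q = s ^ (-r)`.
  set D := 4 * c / (1 - ρ) with hD
  have h1ρ : 0 < 1 - ρ := by linarith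
  have hD0 : 0 < D := by positivity
  have hDρ : D * (1 - ρ) = 4 * c := by rw [hD]; field_simp
  have hs1 : ∀ k : ℕ, 1 ≤ (k : ℝ) + Γ := fun k => by have := k.cast_nonneg (α := ℝ); linarith
  have hspos : ∀ k : ℕ, 0 < (k : ℝ) + Γ := fun k => by linarith [hs1 k]
  have hle1 : ∀ (k : ℕ) {p : ℝ}, 0 ≤ p → ((k : ℝ) + Γ) ^ (-p) ≤ 1 := fun k p hp =>
    Real.rpow_le_one_of_one_le_of_nonpos (hs1 k) (by linarith)
  have hinv : ∀ k : ℕ, ((k : ℝ) + Γ)⁻¹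
      = ((k : ℝ) + Γ) ^ (-(a + b)) * ((k : ℝ) + Γ) ^ (-r) := fun k => by
    rw [← Real.rpow_add (hspos k), ← Real.rpow_neg_one]; congr 1; rw [hr]; ring
  have hinvle : ∀ k : ℕ, ((k : ℝ) + Γ)⁻¹ ≤ 1 := fun k => inv_le_one_of_one_le₀ (hs1 k)
  -- The third condition needs `b < a`, so that `P²` is negligible against `s ^ (-(a + b))`; the
  -- fourth needs `a + b < 1`.
  have hlarge : ∀ᶠ k : ℕ in atTop,
      c * ((k : ℝ) + Γ) ^ (-a) ≤ (1 - ρ) / 4 ∧ ((k : ℝ) + Γ)⁻¹ ≤ (1 - ρ) / 4 ∧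
      c * (1 + D) * (((k : ℝ) + Γ) ^ (-a)) ^ 2 ≤ c₀ / 4 * ((k : ℝ) + Γ) ^ (-(a + b)) ∧
      ((k : ℝ) + Γ)⁻¹ ≤ c₀ / 4 * ((k : ℝ) + Γ) ^ (-(a + b)) ∧
      c₀ * ((k : ℝ) + Γ) ^ (-(a + b)) ≤ 1 := by
    have key : ∀ {p A ε : ℝ}, 0 < p → 0 < ε →
        ∀ᶠ k : ℕ in atTop, A * ((k : ℝ) + Γ) ^ (-p) ≤ ε := fun {p A ε} hp hε => by
      have h := (tendsto_natCast_add_rpow_neg Γ hp).const_mul A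
      rw [mul_zero] at h
      exact h.eventually_le_const hε
    filter_upwards [key (p := a) (A := c) (ε := (1 - ρ) / 4) (by linarith) (by positivity),
      key (p := 1) (A := 1) (ε := (1 - ρ) / 4) one_pos (by positivity),
      key (p := a - b) (A := c * (1 + D)) (ε := c₀ / 4) (by linarith) (by positivity),
      key (p := r) (A := 1) (ε := c₀ / 4) hr0 (by positivity),
      key (p := a + b) (A := c₀) (ε := 1) (by linarith) one_pos] with k h1 h2 h3 h4 h5
    refine ⟨h1, by rwa [one_mul, Real.rpow_neg_one] at h2, ?_, ?_, h5⟩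
    · have : (((k : ℝ) + Γ) ^ (-a)) ^ 2
          = ((k : ℝ) + Γ) ^ (-(a - b)) * ((k : ℝ) + Γ) ^ (-(a + b)) := by
        rw [sq, ← Real.rpow_add (hspos k), ← Real.rpow_add (hspos k)]; congr 1; ring
      rw [this, ← mul_assoc]
      exact mul_le_mul_of_nonneg_right h3 (Real.rpow_nonneg (hspos k).le _)
    · rw [hinv, mul_comm]
      rw [one_mul] at h4
      exact mul_le_mul_of_nonneg_right h4 (Real.rpow_nonneg (hspos k).le _)
  obtain ⟨k₀, hk₀⟩ := eventually_atTop.1 hlarge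
  set g := 3 + 4 * c with hg
  have hg1 : 1 ≤ g := by rw [hg]; linarith
  set S := (k₀ : ℝ) + Γ with hS
  have hS1 : 1 ≤ S := hs1 k₀
  have hSpos : 0 < S := hspos k₀
  -- The first summand covers the steps up to `k₀` for both bounds (`D⁻¹` serves `W`), the second
  -- gives `B ≥ 1`, the third absorbs the source. None depends on the sequences.
  set B₀ := g ^ k₀ * S * (1 + D⁻¹) + 1 + 4 * c / c₀ with hB₀
  have hB₀pos : 0 < B₀ := by positivity
  refine ⟨B₀ * (1 + D), by positivity, fun W Z hW hZ hWr hZr => ?_⟩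
  set T := 1 + Z 0 + W 0 with hT
  have hT1 : 1 ≤ T := by have := hZ 0; have := hW 0; rw [hT]; linarith
  have hgrow : ∀ k, 1 + Z k + W k ≤ g ^ k * T := by
    intro k
    induction k with
    | zero => simp [hT]
    | succ k ih =>
      refine (coupled_step_growth hρ hc hc₀ (Real.rpow_nonneg (hspos k).le (-a))
        (hle1 k (by linarith)) (Real.rpow_nonneg (hspos k).le (-(a + b))) (hinvle k) (hW k) (hZ k)
        (hWr k) (hZr k)).trans ?_
      calc g * (1 + Z k + W k) ≤ g * (g ^ k * T) := mul_le_mul_of_nonneg_left ih (by linarith)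
        _ = _ := by ring
  set B := B₀ * T with hB
  have hBpos : 0 < B := by positivity
  have hB1 : 1 ≤ B := by
    have h1 : 1 ≤ B₀ := by
      have h2 : 0 ≤ g ^ k₀ * S * (1 + D⁻¹) := by positivity
      have h3 : 0 ≤ 4 * c / c₀ := by positivity
      rw [hB₀]; linarith
    rw [hB]; nlinarith
  have hBc : c ≤ B * (c₀ / 4) := by
    have h1 : 4 * c / c₀ ≤ B₀ := by
      have h2 : 0 ≤ g ^ k₀ * S * (1 + D⁻¹) := by positivity
      rw [hB₀]; linarith
    have h2 : 4 * c / c₀ ≤ B := by rw [hB]; nlinarith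
    rw [div_le_iff₀ hc₀] at h2
    linarith
  -- The exponent `-1` is the strongest one needed, so this gives the base case for both rates `r`
  -- and `1 - b`.
  have hearly : ∀ k, k ≤ k₀ → Z k + W k ≤ B * ((k : ℝ) + Γ) ^ (-(1 : ℝ)) ∧
      Z k + W k ≤ B * D * ((k : ℝ) + Γ) ^ (-(1 : ℝ)) := by
    intro k hk
    have h1 : Z k + W k ≤ g ^ k₀ * T := by
      have h2 := hgrow k
      have h3 : g ^ k * T ≤ g ^ k₀ * T :=
        mul_le_mul_of_nonneg_right (pow_le_pow_right₀ hg1 hk) (by linarith)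
      linarith
    have h4 : (k : ℝ) + Γ ≤ S := by rw [hS]; gcongr
    have h5 : 1 ≤ S * ((k : ℝ) + Γ)⁻¹ := by
      rw [← div_eq_mul_inv, le_div_iff₀ (hspos k)]; linarith
    have h6 : 0 < ((k : ℝ) + Γ)⁻¹ := inv_pos.2 (hspos k)
    have h7 : g ^ k₀ * T ≤ g ^ k₀ * S * T * ((k : ℝ) + Γ)⁻¹ := by
      have : 0 ≤ g ^ k₀ * T := by positivity
      nlinarith
    have h8 : 0 ≤ 4 * c / c₀ := by positivity
    have h10 : 0 < g ^ k₀ * S := by positivity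
    rw [Real.rpow_neg_one]
    constructor
    · refine h1.trans (h7.trans (mul_le_mul_of_nonneg_right ?_ h6.le))
      rw [hB]
      refine mul_le_mul_of_nonneg_right ?_ (by linarith)
      have h9 : 0 ≤ g ^ k₀ * S * D⁻¹ := by positivity
      rw [hB₀]; linarith
    · refine h1.trans (h7.trans (mul_le_mul_of_nonneg_right ?_ h6.le))
      rw [hB, mul_right_comm B₀]
      refine mul_le_mul_of_nonneg_right ?_ (by linarith)
      have h9 : B₀ * D = g ^ k₀ * S + (g ^ k₀ * S + 1 + 4 * c / c₀) * D := by
        rw [hB₀]; field_simp; ring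
      rw [h9]
      have : 0 ≤ (g ^ k₀ * S + 1 + 4 * c / c₀) * D := by positivity
      linarith
  have hPQ : ∀ k : ℕ, ((k : ℝ) + Γ) ^ (-(1 - b))
      = ((k : ℝ) + Γ) ^ (-a) * ((k : ℝ) + Γ) ^ (-r) := fun k => by
    rw [← Real.rpow_add (hspos k)]; congr 1; rw [hr]; ring
  have hlate : ∀ k, k₀ ≤ k → Z k ≤ B * ((k : ℝ) + Γ) ^ (-r) ∧
      W k ≤ B * D * ((k : ℝ) + Γ) ^ (-(1 - b)) := by
    intro k hk
    induction k, hk using Nat.le_induction with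
    | base =>
      have h := hearly k₀ le_rfl
      have e : ∀ p : ℝ, p ≤ 1 → S ^ (-(1 : ℝ)) ≤ S ^ (-p) := fun p hp =>
        Real.rpow_le_rpow_of_exponent_le hS1 (by linarith)
      have e1 := mul_le_mul_of_nonneg_left (e r (by linarith)) hBpos.le
      have e2 := mul_le_mul_of_nonneg_left (e (1 - b) (by linarith)) (mul_pos hBpos hD0).le
      have hz := hZ k₀
      have hw := hW k₀
      exact ⟨by linarith [h.1], by linarith [h.2]⟩
    | succ k hk ih =>
      obtain ⟨hz, hw⟩ := ih
      obtain ⟨g1, g2, g3, g4, g5⟩ := hk₀ k hk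
      have r1 := one_sub_inv_mul_rpow_le (hs1 k) (p := r) (by linarith)
      have r2 := one_sub_inv_mul_rpow_le (hs1 k) (p := 1 - b) (by linarith)
      have h1 := hWr k
      have h2 := hZr k
      rw [hPQ] at hw r2
      have hcast : ((k + 1 : ℕ) : ℝ) + Γ = (k : ℝ) + Γ + 1 := by push_cast; ring
      rw [hcast]
      have hTb := Real.rpow_le_rpow_of_exponent_le (hs1 k) (show -(a + b) ≤ -a by linarith)
      have hP0 := Real.rpow_pos_of_pos (hspos k) (-a)
      have hQ0 := Real.rpow_pos_of_pos (hspos k) (-r)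
      have hT0 := Real.rpow_pos_of_pos (hspos k) (-(a + b))
      have hi := hinv k
      have hIle : ((k : ℝ) + Γ)⁻¹ ≤ ((k : ℝ) + Γ) ^ (-a) * ((k : ℝ) + Γ) ^ (-r) := by
        rw [hi]; exact mul_le_mul_of_nonneg_right hTb hQ0.le
      exact ⟨(coupled_step_slow hc hBpos hP0 hQ0 hT0 hi hBc g3 g4 g5 hw hz h2).trans
          (mul_le_mul_of_nonneg_left r1 hBpos.le),
        (coupled_step_fast hρ0 hc hD0 hDρ hB1 hP0 hQ0 hIle g1 g2 hw hz h1).trans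
          (mul_le_mul_of_nonneg_left r2 (mul_pos hBpos hD0).le)⟩
  intro k
  have hQ0 := Real.rpow_pos_of_pos (hspos k) (-r)
  have hBD : 0 < B * D := mul_pos hBpos hD0
  have hBB : B₀ * (1 + D) * T * ((k : ℝ) + Γ) ^ (-r)
      = B * ((k : ℝ) + Γ) ^ (-r) + B * D * ((k : ℝ) + Γ) ^ (-r) := by rw [hB]; ring
  rw [hBB]
  have h1 := mul_pos hBpos hQ0
  have h2 := mul_pos hBD hQ0
  have hw := hW k
  have hz := hZ k
  have hrpow : ∀ p : ℝ, r ≤ p → ((k : ℝ) + Γ) ^ (-p) ≤ ((k : ℝ) + Γ) ^ (-r) := fun p hp =>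
    Real.rpow_le_rpow_of_exponent_le (hs1 k) (by linarith)
  rcases le_total k k₀ with hk | hk
  · have h := (hearly k hk).1
    have e := mul_le_mul_of_nonneg_left (hrpow 1 (by linarith)) hBpos.le
    exact ⟨by linarith, by linarith⟩
  · obtain ⟨hz', hw'⟩ := hlate k hk
    have e := mul_le_mul_of_nonneg_left (hrpow (1 - b) (by linarith)) hBD.le
    exact ⟨by linarith, by linarith⟩

/-! ### Powers of stochastic matrices. -/

section Matrices

variable {m : ℕ}

lemma pow_apply_nonneg {R : Matrix (Fin m) (Fin m) ℝ} (h0 : ∀ i j, 0 ≤ R i j) (k : ℕ)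
    (i j : Fin m) : 0 ≤ (R ^ k) i j := by
  induction k generalizing i j with
  | zero => rw [pow_zero, Matrix.one_apply]; split_ifs <;> norm_num
  | succ k ih =>
    rw [pow_succ, Matrix.mul_apply]
    exact Finset.sum_nonneg fun l _ => mul_nonneg (ih _ _) (h0 _ _)

lemma exists_pow_pos_of_reflTransGen {R : Matrix (Fin m) (Fin m) ℝ} (h0 : ∀ i j, 0 ≤ R i j)
    {r j : Fin m} (h : Relation.ReflTransGen (inducedDigraph R).Adj r j) :
    ∃ k : ℕ, 0 < (R ^ k) j r := by
  have hnn := pow_apply_nonneg h0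
  induction h with
  | refl => exact ⟨0, by simp⟩
  | @tail b c _ hbc ih =>
    obtain ⟨k, hk⟩ := ih
    refine ⟨k + 1, ?_⟩
    rw [pow_succ', Matrix.mul_apply]
    exact Finset.sum_pos' (fun l _ => mul_nonneg (h0 _ _) (hnn _ _ _))
      ⟨b, Finset.mem_univ _, mul_pos hbc hk⟩

/-- A row-stochastic matrix with positive diagonal and a rooted spanning tree has a power with a
positive column. -/
lemma exists_pow_column_ge {R : Matrix (Fin m) (Fin m) ℝ} (h0 : ∀ i j, 0 ≤ R i j)
    (hd : ∀ i, 0 < R i i) (hroot : (treeRoots R).Nonempty) :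
    ∃ (r : Fin m) (N : ℕ) (ε : ℝ), 0 < ε ∧ ∀ i, ε ≤ (R ^ (N + 1)) i r := by
  obtain ⟨r, T, hT⟩ := hroot
  have hex : ∀ j, ∃ k : ℕ, 0 < (R ^ k) j r := fun j =>
    exists_pow_pos_of_reflTransGen h0 (Relation.ReflTransGen.mono hT.sub _ _ (hT.reach j))
  choose k hk using hex
  have hnn := pow_apply_nonneg h0
  -- The positive diagonal keeps an entry positive in all later powers, so one exponent above all `k
  -- j` serves every row.
  have hup : ∀ j, ∀ p, k j ≤ p → 0 < (R ^ p) j r := by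
    intro j p hp
    induction p, hp using Nat.le_induction with
    | base => exact hk j
    | succ p _ ih =>
      rw [pow_succ', Matrix.mul_apply]
      exact Finset.sum_pos' (fun l _ => mul_nonneg (h0 _ _) (hnn _ _ _))
        ⟨j, Finset.mem_univ _, mul_pos (hd j) ih⟩
  have : Nonempty (Fin m) := ⟨r⟩
  set N := ∑ j, k j
  obtain ⟨i₀, hi₀⟩ := Finite.exists_min fun i => (R ^ (N + 1)) i r
  refine ⟨r, N, (R ^ (N + 1)) i₀ r, hup i₀ _ ?_, hi₀⟩
  exact (Finset.single_le_sum (f := k) (fun _ _ => Nat.zero_le _) (Finset.mem_univ i₀)).trans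
    (Nat.le_succ _)

/-- Doeblin's contraction: a row-stochastic matrix with a column bounded below by `ε` maps
vectors close to constants. -/
lemma exists_abs_mulVec_sub_le {P : Matrix (Fin m) (Fin m) ℝ}
    (hP : P ∈ Matrix.rowStochastic ℝ (Fin m)) {r : Fin m} {ε : ℝ} (hε : ∀ i, ε ≤ P i r)
    (t : ℕ) (w : Fin m → ℝ) {M : ℝ} (hw : ∀ i, |w i| ≤ M) :
    ∃ c, ∀ i, |(Matrix.mulVec (P ^ t) w) i - c| ≤ (1 - ε) ^ t * M := by
  induction t with
  | zero => exact ⟨0, by simpa using hw⟩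
  | succ t ih =>
    obtain ⟨c, hc⟩ := ih
    set z : Fin m → ℝ := fun i => (Matrix.mulVec (P ^ t) w) i - c with hz
    -- Removing `ε` from column `r` leaves a nonnegative matrix with row sums `1 - ε`; the removed
    -- part contributes `ε * z r` in every row and joins the constant.
    refine ⟨c + ε * z r, fun i => ?_⟩
    have hrow := Matrix.sum_row_of_mem_rowStochastic hP i
    have h1 : (Matrix.mulVec (P ^ (t + 1)) w) i - (c + ε * z r)
        = ∑ k, (P i k - if k = r then ε else 0) * z k := by
      rw [pow_succ', ← Matrix.mulVec_mulVec]
      simp only [sub_mul, Finset.sum_sub_distrib, ite_mul, zero_mul, Finset.sum_ite_eq',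
        Finset.mem_univ, if_true]
      have h2 : ∑ k, P i k * z k = (Matrix.mulVec P (Matrix.mulVec (P ^ t) w)) i - c := by
        simp only [hz, mul_sub, Finset.sum_sub_distrib, ← Finset.sum_mul, hrow, one_mul]
        rfl
      rw [h2]; ring
    have hnn : ∀ k, 0 ≤ P i k - if k = r then ε else 0 := by
      intro k
      split_ifs with h
      · rw [h]; linarith [hε i]
      · simpa using Matrix.nonneg_of_mem_rowStochastic hP
    rw [h1]
    calc |∑ k, (P i k - if k = r then ε else 0) * z k|
        ≤ ∑ k, (P i k - if k = r then ε else 0) * ((1 - ε) ^ t * M) := by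
          refine (Finset.abs_sum_le_sum_abs _ _).trans (Finset.sum_le_sum fun k _ => ?_)
          rw [abs_mul, abs_of_nonneg (hnn k)]
          exact mul_le_mul_of_nonneg_left (hc k) (hnn k)
      _ = (1 - ε) ^ (t + 1) * M := by
          rw [← Finset.sum_mul, Finset.sum_sub_distrib, hrow]
          simp
          ring

/-- Powers of `R - 1 uᵀ / m` tend to zero. -/
lemma exists_pow_entries_le {R : Matrix (Fin m) (Fin m) ℝ} (h0 : ∀ i j, 0 ≤ R i j)
    (hd : ∀ i, 0 < R i i) (hrow : ∀ i, ∑ j, R i j = 1) (hroot : (treeRoots R).Nonempty)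
    {u : Fin m → ℝ} (hu0 : ∀ i, 0 ≤ u i) (hu : Matrix.vecMul u R = u)
    (hum : ∑ i, u i = (m : ℝ)) {η : ℝ} (hη : 0 < η) :
    ∃ N : ℕ, ∀ i j, |((Matrix.of fun i j => R i j - u j / (m : ℝ)) ^ (N + 1)) i j| ≤ η := by
  obtain ⟨r, N₀, ε, hε, hcol⟩ := exists_pow_column_ge h0 hd hroot
  have hm : (0 : ℝ) < m := by
    have : 0 < m := Nat.pos_of_ne_zero fun h => by subst h; exact r.elim0
    exact_mod_cast this
  have hR : R ∈ Matrix.rowStochastic ℝ (Fin m) :=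
    Matrix.mem_rowStochastic_iff_sum.2 ⟨h0, hrow⟩
  have hPs : ∀ k, R ^ k ∈ Matrix.rowStochastic ℝ (Fin m) := fun k => pow_mem hR k
  have hε1 : ε ≤ 1 := by
    refine (hcol r).trans ?_
    rw [← Matrix.sum_row_of_mem_rowStochastic (hPs (N₀ + 1)) r]
    exact Finset.single_le_sum (f := fun j => (R ^ (N₀ + 1)) r j)
      (fun _ _ => Matrix.nonneg_of_mem_rowStochastic (hPs _)) (Finset.mem_univ r)
  have huk : ∀ k, Matrix.vecMul u (R ^ k) = u := by
    intro k
    induction k with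
    | zero => simp
    | succ k ih => rw [pow_succ, ← Matrix.vecMul_vecMul, ih, hu]
  obtain ⟨t, ht⟩ := exists_pow_lt_of_lt_one (half_pos hη) (show 1 - ε < 1 by linarith)
  have hsmall : ∀ i j, |(R ^ ((N₀ + 1) * (t + 1))) i j - u j / m| ≤ η := by
    intro i j
    rw [pow_mul]
    have hw : ∀ i, |(Pi.single j 1 : Fin m → ℝ) i| ≤ 1 := fun i => by
      rw [Pi.single_apply]; split_ifs <;> simp
    -- Doeblin's bound on a basis vector: column `j` of the power is nearly a constant `c`, and
    -- averaging against the left-invariant `u` shows that `c` is nearly `u j / m`.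
    obtain ⟨c, hc⟩ := exists_abs_mulVec_sub_le (hPs (N₀ + 1)) hcol (t + 1) _ hw
    simp only [Matrix.mulVec_single_one, Matrix.col_apply, mul_one] at hc
    have h1 : ∑ i, u i * ((R ^ (N₀ + 1)) ^ (t + 1)) i j = u j := by
      rw [← pow_mul]; exact congrFun (huk _) j
    have h2 : u j - m * c = ∑ i, u i * (((R ^ (N₀ + 1)) ^ (t + 1)) i j - c) := by
      simp only [mul_sub, Finset.sum_sub_distrib, ← Finset.sum_mul, h1, hum]
    have h3 : |u j - m * c| ≤ m * (1 - ε) ^ (t + 1) := by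
      rw [h2, ← hum, Finset.sum_mul]
      refine (Finset.abs_sum_le_sum_abs _ _).trans (Finset.sum_le_sum fun i _ => ?_)
      rw [abs_mul, abs_of_nonneg (hu0 i)]
      exact mul_le_mul_of_nonneg_left (hc i) (hu0 i)
    have h4 : |u j / m - c| ≤ (1 - ε) ^ (t + 1) := by
      have : u j / m - c = (u j - m * c) / m := by field_simp
      rw [this, abs_div, abs_of_pos hm, div_le_iff₀ hm]; linarith
    have h5 : (1 - ε) ^ (t + 1) ≤ (1 - ε) ^ t :=
      pow_le_pow_of_le_one (by linarith) (by linarith) (Nat.le_succ t)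
    calc |((R ^ (N₀ + 1)) ^ (t + 1)) i j - u j / m|
        = |(((R ^ (N₀ + 1)) ^ (t + 1)) i j - c) - (u j / m - c)| := by ring_nf
      _ ≤ _ := abs_sub _ _
      _ ≤ η := by linarith [hc i]
  obtain ⟨N, hN⟩ : ∃ N, (N₀ + 1) * (t + 1) = N + 1 :=
    Nat.exists_eq_succ_of_ne_zero (by positivity)
  rw [hN] at hsmall
  refine ⟨N, ?_⟩
  set J : Matrix (Fin m) (Fin m) ℝ := Matrix.of fun _ j => u j / (m : ℝ) with hJ
  have hA : (Matrix.of fun i j => R i j - u j / (m : ℝ)) = R - J := by ext i j; simp [hJ]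
  have hRJ : R * J = J := by
    ext i j
    simp only [Matrix.mul_apply, hJ, Matrix.of_apply, ← Finset.sum_mul, hrow, one_mul]
  have hJk : ∀ k, J * R ^ k = J := by
    intro k
    ext i j
    have := congrFun (huk k) j
    simp only [Matrix.mul_apply, hJ, Matrix.of_apply, div_mul_eq_mul_div, ← Finset.sum_div]
    congr 1
  have hJJ : J * J = J := by
    ext i j
    simp only [Matrix.mul_apply, hJ, Matrix.of_apply, ← Finset.sum_mul, ← Finset.sum_div, hum]
    rw [div_self hm.ne', one_mul]
  -- `J` is idempotent and absorbs powers of `R`. The identity fails for exponent zero, hence the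
  -- form `k + 1`.
  have hpow : ∀ k, (R - J) ^ (k + 1) = R ^ (k + 1) - J := by
    intro k
    induction k with
    | zero => simp
    | succ k ih =>
      rw [pow_succ', ih, sub_mul, mul_sub, mul_sub, hRJ, hJk, hJJ, sub_self, sub_zero, ← pow_succ']
  intro i j
  rw [hA, hpow, Matrix.sub_apply]
  exact hsmall i j

end Matrices

/-! ### Mixing operators on families of vectors and adapted norms. -/

section Mixing

variable {m : ℕ} {E : Type*} [NormedAddCommGroup E] [NormedSpace ℝ E]

/-- The action of a matrix on families of vectors. -/
def mix (A : Matrix (Fin m) (Fin m) ℝ) : (Fin m → E) →ₗ[ℝ] (Fin m → E) where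
  toFun x i := ∑ j, A i j • x j
  map_add' x y := by ext1 i; simp [Finset.sum_add_distrib]
  map_smul' c x := by ext1 i; simp [Finset.smul_sum, smul_comm c]

lemma mix_apply (A : Matrix (Fin m) (Fin m) ℝ) (x : Fin m → E) (i : Fin m) :
    mix A x i = ∑ j, A i j • x j := rfl

lemma mix_pow (A : Matrix (Fin m) (Fin m) ℝ) (k : ℕ) : mix (E := E) (A ^ k) = mix A ^ k := by
  induction k with
  | zero =>
    refine LinearMap.ext fun x => funext fun i => ?_
    simp [mix_apply, Matrix.one_apply]
  | succ k ih =>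
    rw [pow_succ', pow_succ', ← ih]
    refine LinearMap.ext fun x => funext fun i => ?_
    simp only [mix_apply, Module.End.mul_apply, Matrix.mul_apply, Finset.sum_smul,
      Finset.smul_sum, mul_smul]
    rw [Finset.sum_comm]

lemma norm_mix_le {A : Matrix (Fin m) (Fin m) ℝ} {η : ℝ} (hη : 0 ≤ η) (hA : ∀ i j, |A i j| ≤ η)
    (x : Fin m → E) : ‖mix A x‖ ≤ m * η * ‖x‖ := by
  refine (pi_norm_le_iff_of_nonneg (by positivity)).2 fun i => ?_
  rw [mix_apply]
  refine (norm_sum_le _ _).trans ?_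
  calc ∑ j, ‖A i j • x j‖ ≤ ∑ _j : Fin m, η * ‖x‖ := by
        refine Finset.sum_le_sum fun j _ => ?_
        rw [norm_smul, Real.norm_eq_abs]
        exact mul_le_mul (hA i j) (norm_le_pi_norm x j) (norm_nonneg _) hη
    _ = _ := by simp [mul_assoc]

lemma exists_norm_mix_le (A : Matrix (Fin m) (Fin m) ℝ) :
    ∃ L : ℝ, 0 ≤ L ∧ ∀ x : Fin m → E, ‖mix A x‖ ≤ L * ‖x‖ := by
  refine ⟨m * ∑ i, ∑ j, |A i j|, by positivity, norm_mix_le (by positivity) fun i j => ?_⟩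
  exact (Finset.single_le_sum (f := fun j => |A i j|) (fun _ _ => abs_nonneg _)
    (Finset.mem_univ j)).trans (Finset.single_le_sum (f := fun i => ∑ j, |A i j|)
    (fun _ _ => Finset.sum_nonneg fun _ _ => abs_nonneg _) (Finset.mem_univ i))

/-- A linear map with a contractive power contracts an equivalent norm. -/
lemma exists_adapted_norm {V : Type*} [NormedAddCommGroup V] [NormedSpace ℝ V] (T : V →ₗ[ℝ] V)
    {L : ℝ} (hL : 0 ≤ L) (hT : ∀ x, ‖T x‖ ≤ L * ‖x‖) {N : ℕ}
    (hN : ∀ x, ‖(T ^ (N + 1)) x‖ ≤ 1 / 2 * ‖x‖) :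
    ∃ (q : V → ℝ) (c ρ : ℝ), 0 ≤ ρ ∧ ρ < 1 ∧ 0 ≤ c ∧ (∀ x y, q (x + y) ≤ q x + q y) ∧
      (∀ x, ‖x‖ ≤ q x) ∧ (∀ x, q x ≤ c * ‖x‖) ∧ ∀ x, q (T x) ≤ ρ * q x := by
  set c := ∑ j ∈ Finset.range (N + 1), L ^ j with hc
  have hc1 : 1 ≤ c := by
    have := Finset.single_le_sum (f := fun j => L ^ j) (fun j _ => pow_nonneg hL j)
      (Finset.mem_range.2 (Nat.succ_pos N))
    simpa using this
  have hpow : ∀ (j : ℕ) x, ‖(T ^ j) x‖ ≤ L ^ j * ‖x‖ := by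
    intro j x
    induction j with
    | zero => simp
    | succ j ih =>
      rw [pow_succ', Module.End.mul_apply, pow_succ', mul_assoc]
      exact (hT _).trans (mul_le_mul_of_nonneg_left ih hL)
  -- Applying `T` shifts this sum: `‖x‖` leaves and `‖T ^ (N + 1) x‖ ≤ ‖x‖ / 2` enters. The loss of
  -- at least `‖x‖ / 2` is a fixed proportion of `q x`, since `q x ≤ c ‖x‖`.
  let q : V → ℝ := fun x => ∑ j ∈ Finset.range (N + 1), ‖(T ^ j) x‖
  have hqc : ∀ x, q x ≤ c * ‖x‖ := fun x => by
    rw [hc, Finset.sum_mul]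
    exact Finset.sum_le_sum fun j _ => hpow j x
  have hinv : 1 / (2 * c) ≤ 1 / 2 := by
    rw [div_le_div_iff₀ (by positivity) (by positivity)]; linarith
  refine ⟨q, c, 1 - 1 / (2 * c), by linarith, ?_, by linarith, ?_, ?_, hqc, ?_⟩
  · have : 0 < 1 / (2 * c) := by positivity
    linarith
  · intro x y
    simp only [q, ← Finset.sum_add_distrib]
    exact Finset.sum_le_sum fun j _ => by rw [map_add]; exact norm_add_le _ _
  · intro x
    have := Finset.single_le_sum (f := fun j => ‖(T ^ j) x‖) (fun j _ => norm_nonneg _)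
      (Finset.mem_range.2 (Nat.succ_pos N))
    simpa using this
  · intro x
    have h1 : q (T x) = q x - ‖x‖ + ‖(T ^ (N + 1)) x‖ := by
      have h2 : q (T x) = ∑ j ∈ Finset.range (N + 1), ‖(T ^ (j + 1)) x‖ :=
        Finset.sum_congr rfl fun j _ => by rw [pow_succ, Module.End.mul_apply]
      have h3 := Finset.sum_range_succ' (fun j => ‖(T ^ j) x‖) (N + 1)
      have h4 := Finset.sum_range_succ (fun j => ‖(T ^ j) x‖) (N + 1)
      simp only [pow_zero, Module.End.one_apply] at h3
      rw [h2]
      simp only [q]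
      linarith
    have h5 : 1 / (2 * c) * q x ≤ 1 / 2 * ‖x‖ := by
      calc 1 / (2 * c) * q x ≤ 1 / (2 * c) * (c * ‖x‖) :=
            mul_le_mul_of_nonneg_left (hqc x) (by positivity)
        _ = 1 / 2 * ‖x‖ := by field_simp
    rw [h1]
    linarith [hN x]

/-- A matrix with powers of small entries contracts a norm on families of vectors. -/
lemma exists_adapted_norm_mix {A : Matrix (Fin m) (Fin m) ℝ}
    (hA : ∀ η : ℝ, 0 < η → ∃ N : ℕ, ∀ i j, |(A ^ (N + 1)) i j| ≤ η) :
    ∃ (q : (Fin m → E) → ℝ) (c ρ : ℝ), 0 ≤ ρ ∧ ρ < 1 ∧ 0 ≤ c ∧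
      (∀ x y, q (x + y) ≤ q x + q y) ∧
      (∀ x, ‖x‖ ≤ q x) ∧ (∀ x, q x ≤ c * ‖x‖) ∧ ∀ x, q (mix A x) ≤ ρ * q x := by
  obtain ⟨L, hL, hLx⟩ := exists_norm_mix_le (E := E) A
  -- Small entries cost a factor `m` in the sup norm; this choice leaves at most `1 / 2`.
  obtain ⟨N, hN⟩ := hA (1 / (2 * (m + 1))) (by positivity)
  refine exists_adapted_norm (V := Fin m → E) (mix A) hL hLx (N := N) fun x => ?_
  rw [← mix_pow]
  refine (norm_mix_le (by positivity) hN x).trans (mul_le_mul_of_nonneg_right ?_ (norm_nonneg x))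
  rw [mul_one_div, div_le_div_iff₀ (by positivity) (by positivity)]
  linarith

end Mixing

/-! ### Equivalence of the prescribed norms with the sup norm. -/

section ColNorm

variable {m n : ℕ}

/-- Continuity bounds `N` above through its values on the basis; compactness of the unit sphere and
definiteness bound it below. -/
lemma exists_seminorm_equiv (N : Seminorm ℝ (Fin m → ℝ)) (hN : ∀ w, N w = 0 → w = 0) :
    ∃ c : ℝ, 0 ≤ c ∧ ∀ w, N w ≤ c * ‖w‖ ∧ ‖w‖ ≤ c * N w := by
  set A := ∑ i, N (Pi.single i 1) with hA
  have hA0 : 0 ≤ A := Finset.sum_nonneg fun _ _ => apply_nonneg N _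
  have hup : ∀ w, N w ≤ A * ‖w‖ := by
    intro w
    have hw : w = ∑ i, w i • (Pi.single i 1 : Fin m → ℝ) := pi_eq_sum_univ' w
    calc N w = N (∑ i, w i • (Pi.single i 1 : Fin m → ℝ)) := by rw [← hw]
      _ ≤ ∑ i, N (w i • (Pi.single i 1 : Fin m → ℝ)) :=
          Finset.le_sum_of_subadditive N (map_zero N).le (map_add_le_add N) _ _
      _ ≤ ∑ i, N (Pi.single i 1) * ‖w‖ := by
          refine Finset.sum_le_sum fun i _ => ?_
          rw [map_smul_eq_mul, mul_comm]
          exact mul_le_mul_of_nonneg_left (norm_le_pi_norm w i) (apply_nonneg N _)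
      _ = A * ‖w‖ := by rw [hA, Finset.sum_mul]
  have hcont : Continuous N := by
    refine (LipschitzWith.of_dist_le_mul (K := ⟨A, hA0⟩) fun x y => ?_).continuous
    rw [Real.dist_eq, dist_eq_norm]
    exact (abs_sub_map_le_sub N x y).trans (hup _)
  obtain ⟨κ, hκ, hκw⟩ : ∃ κ : ℝ, 0 < κ ∧ ∀ w, ‖w‖ = 1 → κ ≤ N w := by
    rcases (Metric.sphere (0 : Fin m → ℝ) 1).eq_empty_or_nonempty with h | h
    · refine ⟨1, one_pos, fun w hw => ?_⟩
      exact absurd (mem_sphere_zero_iff_norm.2 hw) (by rw [h]; simp)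
    · obtain ⟨w₀, hw₀, hmin⟩ := (isCompact_sphere (0 : Fin m → ℝ) 1).exists_isMinOn h
        hcont.continuousOn
      refine ⟨N w₀, lt_of_le_of_ne (apply_nonneg N _) fun h0 => ?_, fun w hw =>
        hmin (mem_sphere_zero_iff_norm.2 hw)⟩
      have := mem_sphere_zero_iff_norm.1 hw₀
      rw [hN w₀ h0.symm, norm_zero] at this
      exact zero_ne_one this
  have hlow : ∀ w, ‖w‖ ≤ κ⁻¹ * N w := by
    intro w
    rcases (norm_nonneg w).eq_or_lt' with h | h
    · rw [h]; exact mul_nonneg (inv_nonneg.2 hκ.le) (apply_nonneg N _)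
    · have h1 := hκw (‖w‖⁻¹ • w) (by rw [norm_smul, norm_inv, norm_norm, inv_mul_cancel₀ h.ne'])
      rw [map_smul_eq_mul, norm_inv, norm_norm, ← div_eq_inv_mul, le_div_iff₀ h] at h1
      rw [← div_eq_inv_mul, le_div_iff₀ hκ, mul_comm]
      exact h1
  have hκ' := inv_pos.2 hκ
  refine ⟨A + κ⁻¹, by positivity, fun w => ⟨?_, ?_⟩⟩
  · have := mul_nonneg hκ'.le (norm_nonneg w)
    linarith [hup w]
  · have := mul_nonneg hA0 (apply_nonneg N w)
    linarith [hlow w]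

/-- The bridge between the consensus errors of the theorem, measured in arbitrary norms, and the
adapted norms in which the contraction takes place. -/
lemma exists_colNorm_equiv (N : Seminorm ℝ (Fin m → ℝ)) (hN : ∀ w, N w = 0 → w = 0) :
    ∃ c : ℝ, 0 ≤ c ∧ ∀ w : Fin m → EuclideanSpace ℝ (Fin n),
      colNorm N (rowsMat w) ≤ c * ‖w‖ ∧ ‖w‖ ≤ c * colNorm N (rowsMat w) := by
  obtain ⟨c, hc, hcw⟩ := exists_seminorm_equiv N hN
  have hcol : ∀ (w : Fin m → EuclideanSpace ℝ (Fin n)) j, ‖fun i => w i j‖ ≤ ‖w‖ := by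
    intro w j
    refine (pi_norm_le_iff_of_nonneg (norm_nonneg w)).2 fun i => ?_
    exact (PiLp.norm_apply_le (w i) j).trans (norm_le_pi_norm w i)
  refine ⟨c * √n + c, by positivity, fun w => ⟨?_, ?_⟩⟩
  · have h1 : colNorm N (rowsMat w) ≤ c * √n * ‖w‖ := by
      refine Real.sqrt_le_iff.2 ⟨by positivity, ?_⟩
      calc ∑ j, N (fun i => rowsMat w i j) ^ 2 ≤ ∑ _j : Fin n, (c * ‖w‖) ^ 2 := by
            refine Finset.sum_le_sum fun j _ => pow_le_pow_left₀ (apply_nonneg N _) ?_ 2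
            exact (hcw _).1.trans (mul_le_mul_of_nonneg_left (hcol w j) hc)
        _ = (c * √n * ‖w‖) ^ 2 := by
            rw [mul_pow, mul_pow, mul_pow, Real.sq_sqrt (Nat.cast_nonneg n)]
            simp
            ring
    have h2 : 0 ≤ c * ‖w‖ := by positivity
    linarith
  · have h0 : 0 ≤ colNorm N (rowsMat w) := Real.sqrt_nonneg _
    have h1 : ‖w‖ ≤ c * colNorm N (rowsMat w) := by
      refine (pi_norm_le_iff_of_nonneg (by positivity)).2 fun i => ?_
      rw [EuclideanSpace.norm_eq]
      refine Real.sqrt_le_iff.2 ⟨by positivity, ?_⟩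
      rw [mul_pow, colNorm, Real.sq_sqrt (Finset.sum_nonneg fun _ _ => sq_nonneg _),
        Finset.mul_sum]
      refine Finset.sum_le_sum fun j _ => ?_
      rw [← mul_pow]
      refine pow_le_pow_left₀ (norm_nonneg _) ?_ 2
      exact (norm_le_pi_norm (fun i => w i j) i).trans (hcw _).2
    have h2 : 0 ≤ c * √n * colNorm N (rowsMat w) := by positivity
    linarith

end ColNorm

/-- Three coupled recursions: two contractions and a slow contraction. -/
lemma exists_rate_of_three_recursions {a b ρ c c₀ Γ : ℝ} (hb : 0 < b) (hba : b < a)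
    (hab : a + b < 1) (hρ0 : 0 ≤ ρ) (hρ : ρ < 1) (hc : 0 < c) (hc₀ : 0 < c₀) (hΓ : 1 ≤ Γ) :
    ∃ K : ℝ, 0 < K ∧ ∀ X Y Z : ℕ → ℝ, (∀ k, 0 ≤ X k) → (∀ k, 0 ≤ Y k) → (∀ k, 0 ≤ Z k) →
      (∀ k : ℕ, X (k + 1) ≤ ρ * X k
        + c * ((k : ℝ) + Γ) ^ (-a) * (Z k + X k + Y k + ((k : ℝ) + Γ)⁻¹)) →
      (∀ k : ℕ, Y (k + 1) ≤ ρ * Y k + c * X k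
        + c * ((k : ℝ) + Γ) ^ (-a) * (Z k + X k + Y k + ((k : ℝ) + Γ)⁻¹)
        + c * ((k : ℝ) + Γ)⁻¹) →
      (∀ k : ℕ, Z (k + 1) ≤
        (1 - c₀ * ((k : ℝ) + Γ) ^ (-(a + b)) + c * (((k : ℝ) + Γ) ^ (-a)) ^ 2)
          * (Z k + c * ((k : ℝ) + Γ)⁻¹) + c * ((k : ℝ) + Γ) ^ (-a) * (X k + Y k)) →
      ∀ k : ℕ, X k ≤ K * (1 + X 0 + Y 0 + Z 0) * ((k : ℝ) + Γ) ^ (-(1 - a - b)) ∧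
        Y k ≤ K * (1 + X 0 + Y 0 + Z 0) * ((k : ℝ) + Γ) ^ (-(1 - a - b)) ∧
        Z k ≤ K * (1 + X 0 + Y 0 + Z 0) * ((k : ℝ) + Γ) ^ (-(1 - a - b)) := by
  have h1ρ : 0 < 1 - ρ := by linarith
  -- In `W = H X + Y` the weight makes `c X ≤ H (1 - ρ) / 2 · X`, so the one-way coupling from `X`
  -- to `Y` only worsens the factor `ρ` to `(1 + ρ) / 2`.
  set H := 2 * c / (1 - ρ) + 1 with hH
  have hH1 : 1 ≤ H := by
    have : 0 < 2 * c / (1 - ρ) := by positivity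
    linarith
  have hHρ : c ≤ H * ((1 - ρ) / 2) := by
    have : H * ((1 - ρ) / 2) = c + (1 - ρ) / 2 := by rw [hH]; field_simp
    linarith
  set c' := (H + 2) * c + c ^ 2 with hc'
  have hHc : 0 < H * c := by positivity
  have hc'c : c ≤ c' := by rw [hc']; nlinarith [sq_nonneg c]
  have hc'1 : (1 + c) * c ≤ c' := by rw [hc']; nlinarith
  have hc'2 : (H + 2) * c ≤ c' := by rw [hc']; nlinarith [sq_nonneg c]
  have hc'0 : 0 < c' := by linarith
  obtain ⟨K, hK, hrate⟩ := exists_rate_of_coupled_recursion (ρ := (1 + ρ) / 2) hb hba hab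
    (by linarith) (by linarith) hc'0 hc₀ hΓ
  refine ⟨K * H, by positivity, fun X Y Z hX hY hZ hXr hYr hZr => ?_⟩
  have hs1 : ∀ k : ℕ, 1 ≤ (k : ℝ) + Γ := fun k => by have := k.cast_nonneg (α := ℝ); linarith
  have hspos : ∀ k : ℕ, 0 < (k : ℝ) + Γ := fun k => by linarith [hs1 k]
  have hP0 : ∀ k : ℕ, 0 ≤ ((k : ℝ) + Γ) ^ (-a) := fun k => Real.rpow_nonneg (hspos k).le _
  have hP1 : ∀ k : ℕ, ((k : ℝ) + Γ) ^ (-a) ≤ 1 := fun k =>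
    Real.rpow_le_one_of_one_le_of_nonpos (hs1 k) (by linarith)
  have hU0 : ∀ k : ℕ, 0 ≤ ((k : ℝ) + Γ) ^ (-(a + b)) := fun k => Real.rpow_nonneg (hspos k).le _
  have hI0 : ∀ k : ℕ, 0 ≤ ((k : ℝ) + Γ)⁻¹ := fun k => (inv_pos.2 (hspos k)).le
  have hW : ∀ k, 0 ≤ H * X k + Y k := fun k => by have := hX k; have := hY k; positivity
  have hXW : ∀ k, X k ≤ H * X k := fun k => by nlinarith [hX k]
  have hmain := hrate (fun k => H * X k + Y k) Z hW hZ ?_ ?_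
  · intro k
    obtain ⟨h1, h2⟩ := hmain k
    have h3 : K * (1 + Z 0 + (H * X 0 + Y 0)) * ((k : ℝ) + Γ) ^ (-(1 - a - b)) ≤
        K * H * (1 + X 0 + Y 0 + Z 0) * ((k : ℝ) + Γ) ^ (-(1 - a - b)) := by
      refine mul_le_mul_of_nonneg_right ?_ (Real.rpow_nonneg (hspos k).le _)
      rw [mul_assoc K H]
      refine mul_le_mul_of_nonneg_left ?_ hK.le
      have := hX 0; have := hY 0; have := hZ 0
      nlinarith
    have := hX k; have := hY k; have := hXW k
    exact ⟨by linarith, by linarith, by linarith⟩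
  · intro k
    have e1 := hXr k
    have e2 := hYr k
    have x0 := hX k
    have y0 := hY k
    have z0 := hZ k
    have xw := hXW k
    have p0 := hP0 k
    have p1 := hP1 k
    have i0 := hI0 k
    set P := ((k : ℝ) + Γ) ^ (-a)
    set I := ((k : ℝ) + Γ)⁻¹
    have e3 : H * X (k + 1) ≤ H * (ρ * X k + c * P * (Z k + X k + Y k + I)) :=
      mul_le_mul_of_nonneg_left e1 (by linarith)
    have e4 : c * X k ≤ H * ((1 - ρ) / 2) * X k := mul_le_mul_of_nonneg_right hHρ x0
    have e5 : (H + 1) * (c * P * (Z k + X k + Y k + I))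
        ≤ (H + 1) * (c * P * (Z k + (H * X k + Y k)) + c * I) := by
      refine mul_le_mul_of_nonneg_left ?_ (by linarith)
      have e6 : c * P * (Z k + X k + Y k) ≤ c * P * (Z k + (H * X k + Y k)) :=
        mul_le_mul_of_nonneg_left (by linarith) (by positivity)
      have e7 : c * (P * I) ≤ c * I :=
        mul_le_mul_of_nonneg_left (by nlinarith) hc.le
      linarith
    have e8 : (H + 1) * c * (P * (Z k + (H * X k + Y k))) ≤ c' * (P * (Z k + (H * X k + Y k))) :=
      mul_le_mul_of_nonneg_right (by linarith) (by positivity)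
    have e9 : (H + 2) * c * I ≤ c' * I := mul_le_mul_of_nonneg_right hc'2 i0
    have e10 : 0 ≤ (1 - ρ) / 2 * Y k := by positivity
    linarith
  · intro k
    refine (hZr k).trans ?_
    have x0 := hX k
    have y0 := hY k
    have z0 := hZ k
    have xw := hXW k
    have p0 := hP0 k
    have p1 := hP1 k
    have i0 := hI0 k
    have u0 := hU0 k
    set P := ((k : ℝ) + Γ) ^ (-a)
    set I := ((k : ℝ) + Γ)⁻¹
    set U := ((k : ℝ) + Γ) ^ (-(a + b))
    have e1 : c * P * (X k + Y k) ≤ c' * P * (H * X k + Y k) := by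
      have : c * P ≤ c' * P := mul_le_mul_of_nonneg_right hc'c p0
      exact mul_le_mul this (by linarith) (by positivity) (by positivity)
    have hP2 : P ^ 2 ≤ 1 := pow_le_one₀ p0 p1
    have e2 : (1 - c₀ * U + c * P ^ 2) * (c * I) ≤ (1 + c) * (c * I) := by
      refine mul_le_mul_of_nonneg_right ?_ (by positivity)
      have : c * P ^ 2 ≤ c * 1 := mul_le_mul_of_nonneg_left hP2 hc.le
      have : 0 ≤ c₀ * U := by positivity
      linarith
    have e3 : (1 + c) * c * I ≤ c' * I := mul_le_mul_of_nonneg_right hc'1 i0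
    have e4 : (1 - c₀ * U + c * P ^ 2) * Z k ≤ (1 - c₀ * U + c' * P ^ 2) * Z k := by
      refine mul_le_mul_of_nonneg_right ?_ z0
      have := mul_le_mul_of_nonneg_right hc'c (sq_nonneg P)
      linarith
    linarith

/-! ### One step of the algorithm: deviations and averages. -/

section Step

variable {m n : ℕ}

/-- The consensus deviation `x - 1 x̄`. -/
noncomputable def devX (u : Fin m → ℝ) (x : Fin m → EuclideanSpace ℝ (Fin n)) :
    Fin m → EuclideanSpace ℝ (Fin n) := fun i => x i - wavg u x

/-- The consensus deviation `y - v ȳ`. -/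
noncomputable def devY (v : Fin m → ℝ) (y : Fin m → EuclideanSpace ℝ (Fin n)) :
    Fin m → EuclideanSpace ℝ (Fin n) := fun i => y i - v i • wavg (fun _ => 1) y

lemma wavg_add (w : Fin m → ℝ) (x y : Fin m → EuclideanSpace ℝ (Fin n)) : wavg w
    (x + y) = wavg w x + wavg w y := by
  simp [wavg, Finset.sum_add_distrib]

lemma wavg_sub (w : Fin m → ℝ) (x y : Fin m → EuclideanSpace ℝ (Fin n)) : wavg w
    (x - y) = wavg w x - wavg w y := by
  simp [wavg, smul_sub]

lemma wavg_const (hm : (m : ℝ) ≠ 0) {w : Fin m → ℝ} (hw : ∑ i, w i = (m : ℝ))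
    (z : EuclideanSpace ℝ (Fin n)) :
    wavg w (fun _ => z) = z := by
  rw [wavg, ← Finset.sum_smul, hw, smul_smul, one_div, inv_mul_cancel₀ hm, one_smul]

lemma norm_wavg_le (hm : (m : ℝ) ≠ 0) {w : Fin m → ℝ} (hw0 : ∀ i, 0 ≤ w i)
    (hw : ∑ i, w i = (m : ℝ)) {x : Fin m → EuclideanSpace ℝ (Fin n)} {M : ℝ} (hx : ∀ i, ‖x i‖ ≤ M) :
    ‖wavg w x‖ ≤ M := by
  have hm0 : (0 : ℝ) < m := lt_of_le_of_ne (Nat.cast_nonneg m) hm.symm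
  rw [wavg, norm_smul, Real.norm_eq_abs, abs_of_pos (by positivity), one_div, ← div_eq_inv_mul,
    div_le_iff₀ hm0, mul_comm, ← hw, Finset.sum_mul]
  refine (norm_sum_le _ _).trans (Finset.sum_le_sum fun i _ => ?_)
  rw [norm_smul, Real.norm_eq_abs, abs_of_nonneg (hw0 i)]
  exact mul_le_mul_of_nonneg_left (hx i) (hw0 i)

lemma wavg_mix_row {R : Matrix (Fin m) (Fin m) ℝ} {u : Fin m → ℝ} (hu : Matrix.vecMul u R = u)
    (x : Fin m → EuclideanSpace ℝ (Fin n)) : wavg u (mix R x) = wavg u x := by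
  rw [wavg, wavg]
  congr 1
  simp only [mix_apply, Finset.smul_sum, smul_smul]
  rw [Finset.sum_comm]
  refine Finset.sum_congr rfl fun j _ => ?_
  rw [← Finset.sum_smul]
  congr 1
  exact congrFun hu j

lemma wavg_mix_col {C : Matrix (Fin m) (Fin m) ℝ} (hC : ∀ j, ∑ i, C i j = 1)
    (y : Fin m → EuclideanSpace ℝ (Fin n)) : wavg (fun _ => 1) (mix C y) = wavg (fun _ => 1) y :=
  wavg_mix_row (by ext j; simp [Matrix.vecMul, dotProduct, hC]) y

lemma mix_sub_row (R : Matrix (Fin m) (Fin m) ℝ) (u : Fin m → ℝ)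
    (x : Fin m → EuclideanSpace ℝ (Fin n)) (i : Fin m) :
    mix (Matrix.of fun i j => R i j - u j / (m : ℝ)) x i = mix R x i - wavg u x := by
  simp only [mix_apply, Matrix.of_apply, sub_smul, Finset.sum_sub_distrib, wavg, Finset.smul_sum,
    smul_smul]
  congr 1
  exact Finset.sum_congr rfl fun j _ => by congr 1; ring

lemma mix_sub_col (C : Matrix (Fin m) (Fin m) ℝ) (v : Fin m → ℝ)
    (y : Fin m → EuclideanSpace ℝ (Fin n)) (i : Fin m) :
    mix (Matrix.of fun i j => C i j - v i / (m : ℝ)) y i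
      = mix C y i - v i • wavg (fun _ => 1) y := by
  simp only [mix_apply, Matrix.of_apply, sub_smul, Finset.sum_sub_distrib, wavg, Finset.smul_sum,
    smul_smul]
  congr 1
  exact Finset.sum_congr rfl fun j _ => by congr 1; ring

/-- `R` fixes constant families and preserves the `u`-average, so deviations evolve under `R -
1uᵀ/m` alone. -/
lemma devX_mix (hm : (m : ℝ) ≠ 0) {R : Matrix (Fin m) (Fin m) ℝ} (hR : ∀ i, ∑ j, R i j = 1)
    {u : Fin m → ℝ} (hu : Matrix.vecMul u R = u) (hum : ∑ i, u i = (m : ℝ))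
    (x g : Fin m → EuclideanSpace ℝ (Fin n)) :
    devX u (mix R (x - g)) = mix (Matrix.of fun i j => R i j - u j / (m : ℝ)) (devX u x)
      + mix (Matrix.of fun i j => R i j - u j / (m : ℝ)) (-g) := by
  rw [← map_add]
  ext1 i
  have h1 : devX u x + -g = (x - g) - fun _ => wavg u x := by
    ext1 i; simp only [devX, Pi.add_apply, Pi.neg_apply, Pi.sub_apply]; abel
  rw [h1, mix_sub_row, wavg_sub u (x - g), wavg_const hm hum, map_sub (mix R) (x - g), Pi.sub_apply]
  have h2 : mix R (fun _ => wavg u x) i = wavg u x := by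
    rw [mix_apply, ← Finset.sum_smul, hR, one_smul]
  rw [h2]
  simp only [devX, wavg_mix_row hu]
  abel

/-- Dual to the row case: `C` preserves the plain average and fixes `v`. -/
lemma devY_mix (hm : (m : ℝ) ≠ 0) {C : Matrix (Fin m) (Fin m) ℝ} (hC : ∀ j, ∑ i, C i j = 1)
    {v : Fin m → ℝ} (hv : Matrix.mulVec C v = v) (hvm : ∑ i, v i = (m : ℝ))
    (y d : Fin m → EuclideanSpace ℝ (Fin n)) :
    devY v (mix C y + d)
      = mix (Matrix.of fun i j => C i j - v i / (m : ℝ)) (devY v y) + devY v d := by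
  ext1 i
  have h0 : devY v y = y - fun i => v i • wavg (fun _ => 1) y := rfl
  have h1 : wavg (fun _ => 1) (fun i => v i • wavg (fun _ => 1) y) = wavg (fun _ => 1) y := by
    conv_rhs => rw [← wavg_const hm hvm (wavg (fun _ => 1) y)]
    simp only [wavg, one_smul]
  have h2 : mix C (fun i => v i • wavg (fun _ => 1) y) i = v i • wavg (fun _ => 1) y := by
    simp only [mix_apply, smul_smul, ← Finset.sum_smul]
    congr 1
    exact congrFun hv i
  rw [Pi.add_apply, mix_sub_col, h0, wavg_sub, h1, sub_self, smul_zero, sub_zero, map_sub,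
    Pi.sub_apply, h2]
  simp only [devY, wavg_add, wavg_mix_col hC, Pi.add_apply, smul_add]
  abel

lemma norm_devY_le (hm : (m : ℝ) ≠ 0) {v : Fin m → ℝ} (hv : ∀ i, |v i| ≤ m)
    (d : Fin m → EuclideanSpace ℝ (Fin n)) :
    ‖devY v d‖ ≤ (1 + m) * ‖d‖ := by
  refine (pi_norm_le_iff_of_nonneg (by positivity)).2 fun i => ?_
  have h1 : ‖wavg (fun _ => 1) d‖ ≤ ‖d‖ :=
    norm_wavg_le hm (fun _ => zero_le_one) (by simp) fun i => norm_le_pi_norm d i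
  calc ‖devY v d i‖ ≤ ‖d i‖ + ‖v i • wavg (fun _ => 1) d‖ := norm_sub_le _ _
    _ ≤ ‖d‖ + m * ‖d‖ := by
        rw [norm_smul, Real.norm_eq_abs]
        exact add_le_add (norm_le_pi_norm d i)
          (mul_le_mul (hv i) h1 (norm_nonneg _) (Nat.cast_nonneg m))
    _ = _ := by ring

lemma norm_mix_row_le {R : Matrix (Fin m) (Fin m) ℝ} (h0 : ∀ i j, 0 ≤ R i j)
    (hR : ∀ i, ∑ j, R i j = 1) (x : Fin m → EuclideanSpace ℝ (Fin n)) : ‖mix R x‖ ≤ ‖x‖ := by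
  refine (pi_norm_le_iff_of_nonneg (norm_nonneg x)).2 fun i => ?_
  rw [mix_apply]
  calc ‖∑ j, R i j • x j‖ ≤ ∑ j, R i j * ‖x‖ := by
        refine (norm_sum_le _ _).trans (Finset.sum_le_sum fun j _ => ?_)
        rw [norm_smul, Real.norm_eq_abs, abs_of_nonneg (h0 i j)]
        exact mul_le_mul_of_nonneg_left (norm_le_pi_norm x j) (h0 i j)
    _ = ‖x‖ := by rw [← Finset.sum_mul, hR, one_mul]

/-- Mixing moves only the deviation, because `R` fixes constants; the increment of the trackers is
therefore controlled without the full size of `x`. -/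
lemma norm_mix_sub_sub_le {R : Matrix (Fin m) (Fin m) ℝ} (h0 : ∀ i j, 0 ≤ R i j)
    (hR : ∀ i, ∑ j, R i j = 1) (u : Fin m → ℝ) (x g : Fin m → EuclideanSpace ℝ (Fin n)) :
    ‖mix R (x - g) - x‖ ≤ 2 * ‖devX u x‖ + ‖g‖ := by
  have h1 : mix R (x - g) - x = mix R (devX u x) - devX u x - mix R g := by
    have h2 : devX u x = x - fun _ => wavg u x := rfl
    have h3 : mix R (fun _ => wavg u x) = fun _ => wavg u x := by
      ext1 i; rw [mix_apply, ← Finset.sum_smul, hR, one_smul]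
    rw [h2, map_sub, map_sub, h3]; abel
  rw [h1]
  have := norm_sub_le (mix R (devX u x) - devX u x) (mix R g)
  have := norm_sub_le (mix R (devX u x)) (devX u x)
  have := norm_mix_row_le h0 hR (devX u x)
  have := norm_mix_row_le h0 hR g
  linarith

lemma norm_smul_family_le {γ : Fin m → ℝ} {gm : ℝ} (hγ0 : ∀ i, 0 ≤ γ i) (hγ : ∀ i, γ i ≤ gm)
    (hgm : 0 ≤ gm) (y : Fin m → EuclideanSpace ℝ (Fin n)) : ‖fun i => γ i • y i‖ ≤ gm * ‖y‖ := by
  refine (pi_norm_le_iff_of_nonneg (by positivity)).2 fun i => ?_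
  rw [norm_smul, Real.norm_eq_abs, abs_of_nonneg (hγ0 i)]
  exact mul_le_mul (hγ i) (norm_le_pi_norm y i) (norm_nonneg _) hgm

variable {u v : Fin m → ℝ} {g : Fin m → EuclideanSpace ℝ (Fin n) → EuclideanSpace ℝ (Fin n)} {L : ℝ}
    {x y : Fin m → EuclideanSpace ℝ (Fin n)} {z : EuclideanSpace ℝ (Fin n)}

lemma norm_apply_sub_le (u : Fin m → ℝ) (x : Fin m → EuclideanSpace ℝ (Fin n))
    (z : EuclideanSpace ℝ (Fin n)) (i : Fin m) :
    ‖x i - z‖ ≤ ‖devX u x‖ + ‖wavg u x - z‖ := by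
  have h1 : x i - z = devX u x i + (wavg u x - z) := by simp [devX]
  rw [h1]
  exact (norm_add_le _ _).trans (add_le_add (norm_le_pi_norm _ i) le_rfl)

/-- The tracked average. -/
lemma wavg_eq_of_tracking (hy : ∑ i, y i = ∑ i, g i (x i)) :
    wavg (fun _ => 1) y = wavg (fun _ => 1) fun i => g i (x i) := by
  simp [wavg, hy]

lemma norm_wavg_tracking_sub_le (hm : (m : ℝ) ≠ 0) (hL : 0 ≤ L)
    (hg : ∀ i z z', ‖g i z - g i z'‖ ≤ L * ‖z - z'‖) (hy : ∑ i, y i = ∑ i, g i (x i)) {κ : ℝ}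
    (hz : ∀ i, ‖x i - z‖ ≤ κ) :
    ‖wavg (fun _ => 1) y - wavg (fun _ => 1) fun i => g i z‖ ≤ L * κ := by
  rw [wavg_eq_of_tracking hy, ← wavg_sub]
  refine norm_wavg_le hm (fun _ => zero_le_one) (by simp) fun i => ?_
  exact (hg i _ _).trans (mul_le_mul_of_nonneg_left (hz i) hL)

/-- The average of `y` equals that of the local maps at `x`, which would vanish if every `x i` were
`z`; Lipschitz continuity measures the defect. -/
lemma norm_tracker_le (hm : (m : ℝ) ≠ 0) (hL : 0 ≤ L)
    (hg : ∀ i z z', ‖g i z - g i z'‖ ≤ L * ‖z - z'‖) (hy : ∑ i, y i = ∑ i, g i (x i))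
    (hv : ∀ i, |v i| ≤ m) (hz : ∑ i, g i z = 0) :
    ‖y‖ ≤ ‖devY v y‖ + m * L * (‖devX u x‖ + ‖wavg u x - z‖) := by
  refine (pi_norm_le_iff_of_nonneg (by positivity)).2 fun i => ?_
  have h0 : wavg (fun _ => 1) (fun i => g i z) = 0 := by simp [wavg, hz]
  have h1 := norm_wavg_tracking_sub_le hm hL hg hy (norm_apply_sub_le u x z)
  rw [h0, sub_zero] at h1
  have h2 : y i = devY v y i + v i • wavg (fun _ => 1) y := by simp [devY]
  rw [h2]
  refine (norm_add_le _ _).trans (add_le_add (norm_le_pi_norm _ i) ?_)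
  rw [norm_smul, Real.norm_eq_abs, mul_assoc]
  exact mul_le_mul (hv i) h1 (norm_nonneg _) (Nat.cast_nonneg m)

/-- One step of the averaged iterate. -/
lemma norm_wavg_step_sub_le (hm : (m : ℝ) ≠ 0) (hL : 0 ≤ L)
    (hg : ∀ i z z', ‖g i z - g i z'‖ ≤ L * ‖z - z'‖) (hy : ∑ i, y i = ∑ i, g i (x i))
    (hv0 : ∀ i, 0 ≤ v i) (hv : ∀ i, v i ≤ m) (hz : ∑ i, g i z = 0)
    (hu0 : ∀ i, 0 ≤ u i) (hum : ∑ i, u i = (m : ℝ))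
    {γ : Fin m → ℝ} {gm τ c L' : ℝ} (hγ0 : ∀ i, 0 ≤ γ i) (hγ : ∀ i, γ i ≤ gm) (hgm : 0 ≤ gm)
    (hτ : 0 ≤ τ) (hα : τ * gm ≤ (1 / (m : ℝ)) * ∑ i, u i * γ i * v i)
    (hc : 0 ≤ c) (hcL : c ≤ L') (hLL : m * L ≤ L')
    (hmono : ∀ z z', c * ‖z - z'‖ ^ 2 ≤ inner ℝ (∑ i, g i z - ∑ i, g i z') (z - z')) {κ : ℝ}
    (hκ : ‖wavg u x - z‖ ≤ κ) :
    ‖wavg u (x - fun i => γ i • y i) - z‖ ≤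
      (1 - τ * gm / m * c + (gm * L') ^ 2 / 2) * κ
        + (m * L * gm * ‖devX u x‖ + gm * ‖devY v y‖) := by
  have hm0 : (0 : ℝ) < m := lt_of_le_of_ne (Nat.cast_nonneg m) hm.symm
  set α := (1 / (m : ℝ)) * ∑ i, u i * γ i * v i with hαdef
  have hα0 : 0 ≤ α := le_trans (by positivity) hα
  have hαm : α ≤ m * gm := by
    have h1 : ∑ i, u i * γ i * v i ≤ ∑ i, u i * (gm * m) :=
      Finset.sum_le_sum fun i _ => by
        rw [mul_assoc]
        exact mul_le_mul_of_nonneg_left (mul_le_mul (hγ i) (hv i) (hv0 i) hgm) (hu0 i)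
    rw [← Finset.sum_mul, hum] at h1
    rw [hαdef, one_div, ← div_eq_inv_mul, div_le_iff₀ hm0]
    linarith
  set G := ∑ i, g i (wavg u x) with hG
  have hw1 : wavg (fun _ => 1) (fun i => g i (wavg u x)) = (1 / (m : ℝ)) • G := by
    simp [wavg, hG]
  -- Where `y` is close to `v ȳ`, the unequal stepsizes act as the single stepsize `α`.
  have hdecomp : wavg u (fun i => γ i • y i)
      = α • wavg (fun _ => 1) y + wavg u (fun i => γ i • devY v y i) := by
    have h1 : (fun i => γ i • y i) = (fun i => (γ i * v i) • wavg (fun _ => 1) y)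
        + fun i => γ i • devY v y i := by
      ext1 i; simp [devY, smul_sub, smul_smul]
    rw [h1, wavg_add]
    congr 1
    rw [wavg, hαdef, ← smul_smul, Finset.sum_smul]
    congr 1
    exact Finset.sum_congr rfl fun i _ => by rw [smul_smul, mul_assoc]
  -- An exact step of size `α / m` along `G`, a tracking error due to disagreement in `x`, and the
  -- deviation of `y`.
  have hmain : wavg u (x - fun i => γ i • y i) - z
      = ((wavg u x - z) - (α / m) • G)
        - α • (wavg (fun _ => 1) y - wavg (fun _ => 1) fun i => g i (wavg u x))
        - wavg u (fun i => γ i • devY v y i) := by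
    rw [wavg_sub, hdecomp, hw1, smul_sub, smul_smul, mul_one_div]; abel
  have b1 : ‖(wavg u x - z) - (α / m) • G‖ ≤
      (1 - τ * gm / m * c + (gm * L') ^ 2 / 2) * κ := by
    have hmono' := hmono (wavg u x) z
    rw [hz, sub_zero] at hmono'
    have hlip : ‖G‖ ≤ L' * ‖wavg u x - z‖ := by
      have h1 : G = ∑ i, (g i (wavg u x) - g i z) := by rw [Finset.sum_sub_distrib, hz, sub_zero]
      rw [h1]
      refine (norm_sum_le _ _).trans ?_
      calc ∑ i, ‖g i (wavg u x) - g i z‖ ≤ ∑ _i : Fin m, L * ‖wavg u x - z‖ :=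
            Finset.sum_le_sum fun i _ => hg i _ _
        _ = m * L * ‖wavg u x - z‖ := by simp [mul_assoc]
        _ ≤ _ := mul_le_mul_of_nonneg_right hLL (norm_nonneg _)
    have hαm0 : 0 ≤ α / m := by positivity
    refine (norm_sub_smul_le_of_strongly_monotone hc hcL hαm0 hmono' hlip).trans ?_
    -- The lower bound on `α` feeds the contraction, this upper bound the second-order term.
    have hαg : α / m ≤ gm := by rw [div_le_iff₀ hm0]; linarith
    have h1 : τ * gm / m ≤ α / m := by gcongr
    have h2 : (α / m * L') ^ 2 ≤ (gm * L') ^ 2 :=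
      pow_le_pow_left₀ (mul_nonneg hαm0 (hc.trans hcL))
        (mul_le_mul_of_nonneg_right hαg (hc.trans hcL)) 2
    have h3 : α / m * c ≤ α / m * L' := mul_le_mul_of_nonneg_left hcL hαm0
    have h4 : 0 ≤ 1 - α / m * c + (α / m * L') ^ 2 / 2 := by
      nlinarith [sq_nonneg (α / m * L' - 1)]
    have h5 := mul_le_mul_of_nonneg_right h1 hc
    exact mul_le_mul (by linarith) hκ (norm_nonneg _) (by linarith)
  have b2 : ‖α • (wavg (fun _ => 1) y - wavg (fun _ => 1) fun i => g i (wavg u x))‖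
      ≤ m * L * gm * ‖devX u x‖ := by
    rw [norm_smul, Real.norm_eq_abs, abs_of_nonneg hα0]
    have h1 := norm_wavg_tracking_sub_le (z := wavg u x) hm hL hg hy
      (κ := ‖devX u x‖) fun i => norm_le_pi_norm (devX u x) i
    calc _ ≤ (m * gm) * (L * ‖devX u x‖) :=
          mul_le_mul hαm h1 (norm_nonneg _) (by positivity)
      _ = _ := by ring
  have b3 : ‖wavg u (fun i => γ i • devY v y i)‖ ≤ gm * ‖devY v y‖ :=
    norm_wavg_le hm hu0 hum fun i => (norm_le_pi_norm _ i).trans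
      (norm_smul_family_le hγ0 hγ hgm (devY v y))
  rw [hmain]
  have := norm_sub_le (((wavg u x - z) - (α / m) • G)
    - α • (wavg (fun _ => 1) y - wavg (fun _ => 1) fun i => g i (wavg u x)))
    (wavg u (fun i => γ i • devY v y i))
  have := norm_sub_le ((wavg u x - z) - (α / m) • G)
    (α • (wavg (fun _ => 1) y - wavg (fun _ => 1) fun i => g i (wavg u x)))
  linarith

end Step

/-! ### The stepsize and regularization sequences. -/

lemma decay_succ {c Γ p : ℝ} (hΓ : 0 ≤ Γ) (k : ℕ) :
    decay c Γ p (k + 1) = c * ((k : ℝ) + (Γ + 1)) ^ (-p) := by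
  have h : ((k + 1 : ℕ) : ℝ) + Γ = (k : ℝ) + (Γ + 1) := by push_cast; ring
  rw [decay, h, Real.rpow_neg (by positivity), div_eq_mul_inv]

lemma decay_pos {c Γ p : ℝ} (hc : 0 < c) (hΓ : 0 < Γ) (k : ℕ) : 0 < decay c Γ p k := by
  unfold decay; positivity

lemma tendsto_decay (c Γ : ℝ) {p : ℝ} (hp : 0 < p) :
    Tendsto (decay c Γ p) atTop (𝓝 0) :=
  Tendsto.const_div_atTop ((tendsto_rpow_atTop hp).comp
    (tendsto_atTop_add_const_right _ _ tendsto_natCast_atTop_atTop)) c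

/-- The ratio of consecutive terms is `t ^ p` with `t = 1 - 1 / (k + Γ + 1)`, and `t ≤ t ^ p ≤ 1`
for `0 ≤ p ≤ 1`. -/
lemma relDecr_decay_le {c Γ p : ℝ} (hc : 0 < c) (hΓ : 0 < Γ) (hp0 : 0 ≤ p) (hp : p ≤ 1) (k : ℕ) :
    relDecr (decay c Γ p) k ≤ ((k : ℝ) + (Γ + 1))⁻¹ := by
  have hs : 0 < (k : ℝ) + Γ := by positivity
  have h : ((k + 1 : ℕ) : ℝ) + Γ = (k : ℝ) + (Γ + 1) := by push_cast; ring
  have hs' : 0 < (k : ℝ) + (Γ + 1) := by positivity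
  set t := ((k : ℝ) + Γ) / ((k : ℝ) + (Γ + 1)) with ht
  have ht0 : 0 < t := by positivity
  have ht1 : t ≤ 1 := by rw [ht, div_le_one hs']; linarith
  have h1 : decay c Γ p (k + 1) / decay c Γ p k = t ^ p := by
    rw [decay, decay, h, ht, Real.div_rpow hs.le hs'.le]
    field_simp
  have h2 : t ^ p ≤ 1 := Real.rpow_le_one ht0.le ht1 hp0
  have h3 : t ≤ t ^ p := by
    simpa using Real.rpow_le_rpow_of_exponent_ge ht0 ht1 hp
  have h4 : 1 - t = ((k : ℝ) + (Γ + 1))⁻¹ := by rw [ht]; field_simp; ring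
  rw [relDecr, h1, abs_of_nonneg (by linarith)]
  linarith

lemma abs_decay_succ_sub_le {c Γ p : ℝ} (hc : 0 < c) (hΓ : 1 ≤ Γ) (hp0 : 0 ≤ p) (hp : p ≤ 1)
    (k : ℕ) : |decay c Γ p (k + 1) - decay c Γ p k| ≤ c * ((k : ℝ) + (Γ + 1))⁻¹ := by
  have h0 := decay_pos (p := p) hc (show 0 < Γ by linarith) k
  have h1 : |decay c Γ p (k + 1) - decay c Γ p k| = decay c Γ p k * relDecr (decay c Γ p) k := by
    rw [relDecr, ← abs_of_pos h0, ← abs_mul, abs_of_pos h0, abs_sub_comm]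
    congr 1; field_simp
  have h2 : decay c Γ p k ≤ c := by
    unfold decay
    exact div_le_self hc.le (Real.one_le_rpow (by have := k.cast_nonneg (α := ℝ); linarith) hp0)
  rw [h1]
  exact mul_le_mul h2 (relDecr_decay_le hc (by linarith) hp0 hp k) (abs_nonneg _) hc.le

/-! ### The algorithm and its uniform rate. -/

section Algorithm

variable {m n : ℕ}

lemma irPushPull_fst_succ (f : Fin m → EuclideanSpace ℝ (Fin n) → ℝ)
    (F : Fin m → EuclideanSpace ℝ (Fin n) → EuclideanSpace ℝ (Fin n))
    (R C : Matrix (Fin m) (Fin m) ℝ) (l : ℕ → ℝ) (γ : ℕ → Fin m → ℝ)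
    (x0 : Fin m → EuclideanSpace ℝ (Fin n)) (k : ℕ) :
    (irPushPull f F R C l γ x0 (k + 1)).1 = mix R ((irPushPull f F R C l γ x0 k).1
      - fun i => γ k i • (irPushPull f F R C l γ x0 k).2 i) := rfl

lemma irPushPull_snd_succ (f : Fin m → EuclideanSpace ℝ (Fin n) → ℝ)
    (F : Fin m → EuclideanSpace ℝ (Fin n) → EuclideanSpace ℝ (Fin n))
    (R C : Matrix (Fin m) (Fin m) ℝ) (l : ℕ → ℝ) (γ : ℕ → Fin m → ℝ)
    (x0 : Fin m → EuclideanSpace ℝ (Fin n)) (k : ℕ) :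
    (irPushPull f F R C l γ x0 (k + 1)).2 = mix C (irPushPull f F R C l γ x0 k).2 + fun i =>
      (F i ((irPushPull f F R C l γ x0 (k + 1)).1 i)
        + l (k + 1) • gradient (f i) ((irPushPull f F R C l γ x0 (k + 1)).1 i))
      - (F i ((irPushPull f F R C l γ x0 k).1 i)
        + l k • gradient (f i) ((irPushPull f F R C l γ x0 k).1 i)) := by
  ext1 i
  simp only [irPushPull, Pi.add_apply, mix_apply]
  abel

/-- Gradient tracking: the trackers sum up to the current local maps. -/
lemma sum_irPushPull_snd {f : Fin m → EuclideanSpace ℝ (Fin n) → ℝ}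
    {F : Fin m → EuclideanSpace ℝ (Fin n) → EuclideanSpace ℝ (Fin n)}
    {R C : Matrix (Fin m) (Fin m) ℝ} (hC : ∀ j, ∑ i, C i j = 1) (l : ℕ → ℝ) (γ : ℕ → Fin m → ℝ)
    (x0 : Fin m → EuclideanSpace ℝ (Fin n)) (k : ℕ) :
    ∑ i, (irPushPull f F R C l γ x0 k).2 i = ∑ i, (F i ((irPushPull f F R C l γ x0 k).1 i)
      + l k • gradient (f i) ((irPushPull f F R C l γ x0 k).1 i)) := by
  induction k with
  | zero => rfl
  | succ k ih =>
    rw [irPushPull_snd_succ]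
    simp only [Pi.add_apply]
    rw [Finset.sum_add_distrib, Finset.sum_sub_distrib, ← ih]
    have h : ∑ i, mix C (irPushPull f F R C l γ x0 k).2 i
        = ∑ i, (irPushPull f F R C l γ x0 k).2 i := by
      simp only [mix_apply]
      rw [Finset.sum_comm]
      exact Finset.sum_congr rfl fun j _ => by rw [← Finset.sum_smul, hC, one_smul]
    rw [h, add_sub_cancel]

lemma lipschitz_local_map {f : Fin m → EuclideanSpace ℝ (Fin n) → ℝ}
    {F : Fin m → EuclideanSpace ℝ (Fin n) → EuclideanSpace ℝ (Fin n)} {μf Lf LF : ℝ}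
    (hprob : ProblemAssumption f F μf Lf LF) {lam Γ b : ℝ} (hlam : 0 < lam) (hΓ : 1 ≤ Γ)
    (hb : 0 ≤ b) (k : ℕ) (i : Fin m) (z z' : EuclideanSpace ℝ (Fin n)) :
    ‖F i z + decay lam Γ b k • gradient (f i) z - (F i z' + decay lam Γ b k • gradient (f i) z')‖
      ≤ (LF + lam * Lf) * ‖z - z'‖ := by
  have hl0 := decay_pos (p := b) hlam (show 0 < Γ by linarith) k
  have hl : decay lam Γ b k ≤ lam := by
    unfold decay
    exact div_le_self hlam.le (Real.one_le_rpow (by have := k.cast_nonneg (α := ℝ); linarith) hb)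
  have h1 : F i z + decay lam Γ b k • gradient (f i) z
      - (F i z' + decay lam Γ b k • gradient (f i) z')
      = (F i z - F i z') + decay lam Γ b k • (gradient (f i) z - gradient (f i) z') := by
    rw [smul_sub]; abel
  rw [h1, add_mul, mul_assoc]
  refine (norm_add_le _ _).trans (add_le_add (hprob.lip i z z') ?_)
  rw [norm_smul, Real.norm_eq_abs, abs_of_pos hl0]
  exact mul_le_mul hl ((hprob.smooth i).lip z z') (norm_nonneg _) hlam.le

lemma sum_local_map {f : Fin m → EuclideanSpace ℝ (Fin n) → ℝ}
    {F : Fin m → EuclideanSpace ℝ (Fin n) → EuclideanSpace ℝ (Fin n)}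
    (hf : ∀ i, Differentiable ℝ (f i)) (l : ℝ) (z : EuclideanSpace ℝ (Fin n)) :
    ∑ i, (F i z + l • gradient (f i) z) = sumMap F z + l • gradient (sumObj f) z := by
  rw [Finset.sum_add_distrib, ← Finset.smul_sum, gradient_sumObj hf, sumMap]

lemma strongly_monotone_sum_local_map {f : Fin m → EuclideanSpace ℝ (Fin n) → ℝ}
    {F : Fin m → EuclideanSpace ℝ (Fin n) → EuclideanSpace ℝ (Fin n)} {μf Lf LF : ℝ}
    (hprob : ProblemAssumption f F μf Lf LF) {l : ℝ} (hl : 0 ≤ l)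
    (z z' : EuclideanSpace ℝ (Fin n)) :
    l * μf * ‖z - z'‖ ^ 2 ≤ inner ℝ (∑ i, (F i z + l • gradient (f i) z)
      - ∑ i, (F i z' + l • gradient (f i) z')) (z - z') := by
  have hf : ∀ i, Differentiable ℝ (f i) := fun i =>
    (hprob.smooth i).contDiff.differentiable one_ne_zero
  have h1 : sumMap F z + l • gradient (sumObj f) z - (sumMap F z' + l • gradient (sumObj f) z')
      = (sumMap F z - sumMap F z') + l • (gradient (sumObj f) z - gradient (sumObj f) z') := by
    rw [smul_sub]; abel
  rw [sum_local_map hf, sum_local_map hf, h1, inner_add_left, real_inner_smul_left]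
  have h2 := mul_le_mul_of_nonneg_left (hprob.strong.mono z z') hl
  linarith [hprob.mono z z']

set_option maxHeartbeats 2000000 in
/-- The consensus errors and the distance to a Tikhonov trajectory decay at a rate whose constant
is uniform in the stepsizes and the initial points. -/
theorem exists_uniform_rate
    {f : Fin m → EuclideanSpace ℝ (Fin n) → ℝ}
    {F : Fin m → EuclideanSpace ℝ (Fin n) → EuclideanSpace ℝ (Fin n)}
    {μf Lf LF : ℝ} (hprob : ProblemAssumption f F μf Lf LF)
    {R C : Matrix (Fin m) (Fin m) ℝ} (hmix : MixingAssumption R C)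
    {u v : Fin m → ℝ}
    (hu0 : ∀ i, 0 ≤ u i) (hu : Matrix.vecMul u R = u) (hum : ∑ i, u i = (m : ℝ))
    (hv0 : ∀ i, 0 ≤ v i) (hv : Matrix.mulVec C v = v) (hvm : ∑ i, v i = (m : ℝ))
    {NR NC : Seminorm ℝ (Fin m → ℝ)}
    (hNR : ∀ w, NR w = 0 → w = 0) (hNC : ∀ w, NC w = 0 → w = 0)
    {gam lam Γ a b θ : ℝ} (hgam : 0 < gam) (hlam : 0 < lam) (hΓ : 1 ≤ Γ)
    (hb : 0 < b) (hba : b < a) (hab : a + b < 1) (hθ : 0 < θ)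
    {xt : ℕ → EuclideanSpace ℝ (Fin n)} {M₀ G₀ : ℝ} (hM₀ : 0 ≤ M₀) (hG₀ : 0 ≤ G₀)
    (hxt : ∀ k, ∑ i, (F i (xt k) + decay lam Γ b k • gradient (f i) (xt k)) = 0)
    (hxtM : ∀ k, ‖xt (k + 1) - xt k‖ ≤ M₀ * relDecr (decay lam Γ b) k)
    (hxtG : ∀ k i, ‖gradient (f i) (xt k)‖ ≤ G₀) :
    ∃ K : ℝ, 0 < K ∧ ∀ (γ : ℕ → Fin m → ℝ) (x0 : Fin m → EuclideanSpace ℝ (Fin n)),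
      IsStepsize u v (decay gam Γ a) θ γ →
      let x := fun k => (irPushPull f F R C (decay lam Γ b) γ x0 k).1
      let y := fun k => (irPushPull f F R C (decay lam Γ b) γ x0 k).2
      let Δ₁ := √(‖wavg u (x 1) - xt 0‖ ^ 2 + errX NR u (x 1) ^ 2 + errY NC v (y 1) ^ 2)
      ∀ k : ℕ,
        errX NR u (x (k + 1)) ≤ K * (1 + Δ₁) * ((k : ℝ) + (Γ + 1)) ^ (-(1 - a - b)) ∧
        errY NC v (y (k + 1)) ≤ K * (1 + Δ₁) * ((k : ℝ) + (Γ + 1)) ^ (-(1 - a - b)) ∧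
        ‖wavg u (x (k + 1)) - xt k‖
          ≤ K * (1 + Δ₁) * ((k : ℝ) + (Γ + 1)) ^ (-(1 - a - b)) := by
  have hm0 : 0 < m := by
    obtain ⟨r, -⟩ := hmix.roots
    exact r.pos
  have hm : (m : ℝ) ≠ 0 := by exact_mod_cast hm0.ne'
  have hmpos : (0 : ℝ) < m := by exact_mod_cast hm0
  have hΓ0 : 0 < Γ := by linarith
  have ha : 0 < a := by linarith
  have hμf := hprob.μf_pos
  have hvle : ∀ i, v i ≤ m := fun i => by
    rw [← hvm]; exact Finset.single_le_sum (fun j _ => hv0 j) (Finset.mem_univ i)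
  have hvabs : ∀ i, |v i| ≤ m := fun i => by rw [abs_of_nonneg (hv0 i)]; exact hvle i
  set AR : Matrix (Fin m) (Fin m) ℝ := Matrix.of fun i j => R i j - u j / (m : ℝ) with hAR
  set AC : Matrix (Fin m) (Fin m) ℝ := Matrix.of fun i j => C i j - v i / (m : ℝ) with hAC
  obtain ⟨qR, cR, ρR, hρR0, hρR1, hcR, hqRadd, hqR1, hqR2, hqRmix⟩ :=
    exists_adapted_norm_mix (E := EuclideanSpace ℝ (Fin n)) (A := AR) fun η hη =>
      exists_pow_entries_le hmix.R_nonneg hmix.R_diag hmix.R_row (hmix.roots.mono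
        Set.inter_subset_left) hu0 hu hum hη
  obtain ⟨qC, cC, ρC, hρC0, hρC1, hcC, hqCadd, hqC1, hqC2, hqCmix⟩ :=
    exists_adapted_norm_mix (E := EuclideanSpace ℝ (Fin n)) (A := AC) fun η hη => by
      -- The column-stochastic case is the row-stochastic one for the transpose, whose
      -- left-invariant vector is `v`.
      obtain ⟨N, hN⟩ := exists_pow_entries_le (R := C.transpose) (u := v)
        (fun i j => hmix.C_nonneg j i) hmix.C_diag hmix.C_col
        (hmix.roots.mono Set.inter_subset_right) hv0
        (by rw [Matrix.vecMul_transpose]; exact hv) hvm hη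
      refine ⟨N, fun i j => ?_⟩
      have hT : AC = (Matrix.of fun i j => C.transpose i j - v j / (m : ℝ)).transpose := rfl
      rw [hT, ← Matrix.transpose_pow]
      exact hN j i
  obtain ⟨lR, hlR, hlRx⟩ := exists_norm_mix_le (E := EuclideanSpace ℝ (Fin n)) AR
  obtain ⟨eR, heR, heRx⟩ := exists_colNorm_equiv (n := n) NR hNR
  obtain ⟨eC, heC, heCx⟩ := exists_colNorm_equiv (n := n) NC hNC
  set L := LF + lam * Lf with hL
  have hL0 : 0 ≤ L := by
    have := hprob.LF_nonneg; have := hprob.Lf_pos; positivity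
  set L' := m * L + lam * μf with hL'
  have hL'0 : 0 ≤ L' := by positivity
  set ρ := max ρR ρC with hρ
  -- the trackers are bounded by `cy * (Z + X + Y + I)`
  set cy := 1 + m * L * (1 + M₀) with hcy
  have hcy0 : 0 < cy := by positivity
  set c1 := cR * lR * gam * cy with hc1
  set cd := L * 2 + L * gam * cy + lam * G₀ + lam * Lf * (1 + M₀) with hcd
  set c2 := cC * (1 + m) * cd with hc2
  set c3 := (gam * L') ^ 2 / 2 + M₀ with hc3
  set c4 := m * L * gam + gam with hc4
  have hLf := hprob.Lf_pos
  have hcd0 : 0 ≤ cd := by positivity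
  have hc10 : 0 ≤ c1 := by positivity
  have hc20 : 0 ≤ c2 := by positivity
  have hc30 : 0 ≤ c3 := by positivity
  have hc40 : 0 ≤ c4 := by positivity
  set c := c1 + c2 + c3 + c4 + 1 with hc
  set c₀ := θ * gam / m * (lam * μf) with hc₀
  obtain ⟨K, hK, hrate⟩ := exists_rate_of_three_recursions (ρ := ρ) (c := c) (c₀ := c₀)
    (Γ := Γ + 1) hb hba hab (hρR0.trans (le_max_left _ _)) (max_lt hρR1 hρC1) (by positivity)
    (by positivity) (by linarith)
  refine ⟨(eR + eC + 1) * (K * (1 + cR * eR + cC * eC + 1)), by positivity,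
    fun γ x0 hγ => ?_⟩
  have hcpos : 0 < c := by positivity
  have hρR : ρR ≤ ρ := le_max_left _ _
  have hρC : ρC ≤ ρ := le_max_right _ _
  clear_value c c₀ c1 c2 c3 c4 cd cy L' ρ
  intro x y Δ₁
  set X : ℕ → ℝ := fun k => qR (devX u (x (k + 1))) with hX
  set Y : ℕ → ℝ := fun k => qC (devY v (y (k + 1))) with hY
  -- The average at time `k + 1` is compared with the zero for time `k`, while the next step aims at
  -- the zero for time `k + 1`. The drift therefore enters before the contraction.
  set Z : ℕ → ℝ := fun k => ‖wavg u (x (k + 1)) - xt k‖ with hZ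
  have hX0 : ∀ k, 0 ≤ X k := fun k => (norm_nonneg _).trans (hqR1 _)
  have hY0 : ∀ k, 0 ≤ Y k := fun k => (norm_nonneg _).trans (hqC1 _)
  have hZ0 : ∀ k, 0 ≤ Z k := fun k => norm_nonneg _
  have hstep : ∀ k : ℕ,
      X (k + 1) ≤ ρ * X k
        + c * ((k : ℝ) + (Γ + 1)) ^ (-a) * (Z k + X k + Y k + ((k : ℝ) + (Γ + 1))⁻¹) ∧
      Y (k + 1) ≤ ρ * Y k + c * X k
        + c * ((k : ℝ) + (Γ + 1)) ^ (-a) * (Z k + X k + Y k + ((k : ℝ) + (Γ + 1))⁻¹)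
        + c * ((k : ℝ) + (Γ + 1))⁻¹ ∧
      Z (k + 1) ≤
        (1 - c₀ * ((k : ℝ) + (Γ + 1)) ^ (-(a + b)) + c * (((k : ℝ) + (Γ + 1)) ^ (-a)) ^ 2)
          * (Z k + c * ((k : ℝ) + (Γ + 1))⁻¹)
          + c * ((k : ℝ) + (Γ + 1)) ^ (-a) * (X k + Y k) := by
    intro k
    set s := (k : ℝ) + (Γ + 1) with hs
    have hs1 : 1 ≤ s := by have := k.cast_nonneg (α := ℝ); rw [hs]; linarith
    have hs0 : 0 < s := by linarith
    set P := s ^ (-a) with hP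
    set U := s ^ (-(a + b)) with hU
    set I := s⁻¹ with hI
    have hP0 : 0 ≤ P := Real.rpow_nonneg hs0.le _
    have hI0 : 0 ≤ I := inv_nonneg.2 hs0.le
    have hIP : I ≤ P := by
      rw [hI, hP, ← Real.rpow_neg_one]
      exact Real.rpow_le_rpow_of_exponent_le hs1 (by linarith)
    set l := decay lam Γ b (k + 1) with hl
    set gm := decay gam Γ a (k + 1) with hgm
    have hgmP : gm = gam * P := decay_succ hΓ0.le k
    have hlU : l = lam * s ^ (-b) := decay_succ hΓ0.le k
    have hUP : P * s ^ (-b) = U := by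
      rw [hP, hU, ← Real.rpow_add hs0]; congr 1; ring
    have hgm0 : 0 ≤ gm := by rw [hgmP]; positivity
    have hx0 := hX0 k
    have hy0 := hY0 k
    have hz0 := hZ0 k
    have hnX : ‖devX u (x (k + 1))‖ ≤ X k := hqR1 _
    have hnY : ‖devY v (y (k + 1))‖ ≤ Y k := hqC1 _
    have hlip := lipschitz_local_map hprob hlam hΓ hb.le
    have hdist : ‖wavg u (x (k + 1)) - xt (k + 1)‖ ≤ Z k + M₀ * I := by
      have h1 := norm_sub_le_norm_sub_add_norm_sub (wavg u (x (k + 1))) (xt k) (xt (k + 1))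
      have h2 := hxtM k
      rw [norm_sub_rev] at h2
      have h3 := mul_le_mul_of_nonneg_left
        (relDecr_decay_le (p := b) hlam hΓ0 hb.le (by linarith) k) hM₀
      linarith
    have htrack := sum_irPushPull_snd (f := f) (F := F) (R := R) hmix.C_col (decay lam Γ b) γ x0
      (k + 1)
    set S := Z k + X k + Y k + I with hS
    have hS0 : 0 ≤ S := by positivity
    have hXZS : X k + (Z k + M₀ * I) ≤ (1 + M₀) * S := by
      have h1 : 0 ≤ M₀ * (Z k + X k + Y k) := by positivity
      rw [hS]; linarith
    have hyn : ‖y (k + 1)‖ ≤ cy * S := by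
      have h1 := norm_tracker_le (u := u) hm hL0 (hlip (k + 1)) htrack hvabs (hxt (k + 1))
      have h2 : m * L * (‖devX u (x (k + 1))‖ + ‖wavg u (x (k + 1)) - xt (k + 1)‖)
          ≤ m * L * ((1 + M₀) * S) :=
        mul_le_mul_of_nonneg_left (by linarith) (by positivity)
      have h3 : Y k ≤ S := by rw [hS]; linarith
      have h4 : cy * S = S + m * L * ((1 + M₀) * S) := by rw [hcy]; ring
      rw [h4]
      exact h1.trans (by linarith)
    set gy : Fin m → EuclideanSpace ℝ (Fin n) := fun i => γ (k + 1) i • y (k + 1) i with hgy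
    have hγle : ∀ i, γ (k + 1) i ≤ gm := fun i => (hγ.isMax (k + 1)).2 ⟨i, rfl⟩
    have hgyn : ‖gy‖ ≤ gam * cy * (P * S) := by
      refine (norm_smul_family_le (hγ.nonneg (k + 1)) hγle hgm0 (y (k + 1))).trans ?_
      calc gm * ‖y (k + 1)‖ ≤ gm * (cy * S) := mul_le_mul_of_nonneg_left hyn hgm0
        _ = gam * cy * (P * S) := by rw [hgmP]; ring
    have hxs : x (k + 1 + 1) = mix R (x (k + 1) - gy) := irPushPull_fst_succ ..
    have hPS0 : 0 ≤ P * S := mul_nonneg hP0 hS0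
    refine ⟨?_, ?_, ?_⟩
    · have h1 : X (k + 1) ≤ ρR * X k + cR * (lR * ‖gy‖) := by
        have h2 : X (k + 1) = qR (mix AR (devX u (x (k + 1))) + mix AR (-gy)) := by
          simp only [hX]; rw [hxs, devX_mix hm hmix.R_row hu hum]
        rw [h2]
        refine (hqRadd _ _).trans (add_le_add (hqRmix _) ((hqR2 _).trans ?_))
        have h3 := hlRx (-gy)
        rw [norm_neg] at h3
        exact mul_le_mul_of_nonneg_left h3 hcR
      have h4 : ρR * X k ≤ ρ * X k := mul_le_mul_of_nonneg_right hρR hx0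
      have h5 : cR * (lR * ‖gy‖) ≤ cR * (lR * (gam * cy * (P * S))) := by gcongr
      have h6 : c1 * (P * S) ≤ c * (P * S) :=
        mul_le_mul_of_nonneg_right (by rw [hc]; linarith) hPS0
      have h7 : cR * (lR * (gam * cy * (P * S))) = c1 * (P * S) := by rw [hc1]; ring
      linarith
    · set d : Fin m → EuclideanSpace ℝ (Fin n) := fun i =>
        (F i (x (k + 1 + 1) i) + decay lam Γ b (k + 1 + 1) • gradient (f i) (x (k + 1 + 1) i))
        - (F i (x (k + 1) i) + l • gradient (f i) (x (k + 1) i)) with hd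
      have hys : y (k + 1 + 1) = mix C (y (k + 1)) + d := irPushPull_snd_succ ..
      have hdn : ‖d‖ ≤ cd * (X k + P * S + I) := by
        have hxx : ‖x (k + 1 + 1) - x (k + 1)‖ ≤ 2 * X k + gam * cy * (P * S) := by
          rw [hxs]
          have := norm_mix_sub_sub_le hmix.R_nonneg hmix.R_row u (x (k + 1)) gy
          linarith
        have hll : |decay lam Γ b (k + 1 + 1) - l| ≤ lam * I := by
          refine (abs_decay_succ_sub_le hlam hΓ hb.le (by linarith) (k + 1)).trans ?_
          refine mul_le_mul_of_nonneg_left ?_ hlam.le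
          refine inv_anti₀ hs0 ?_
          rw [hs]; push_cast; linarith
        have hbound : ∀ i, ‖d i‖ ≤ L * (2 * X k + gam * cy * (P * S))
            + lam * I * (G₀ + Lf * ((1 + M₀) * S)) := by
          intro i
          -- The increment of the local map splits into a move of the point at fixed regularization
          -- and a change of regularization at a fixed point.
          have h1 : d i = ((F i (x (k + 1 + 1) i)
                + decay lam Γ b (k + 1 + 1) • gradient (f i) (x (k + 1 + 1) i))
              - (F i (x (k + 1) i) + decay lam Γ b (k + 1 + 1) • gradient (f i) (x (k + 1) i)))
              + (decay lam Γ b (k + 1 + 1) - l) • gradient (f i) (x (k + 1) i) := by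
            simp only [hd, sub_smul]; abel
          rw [h1]
          refine (norm_add_le _ _).trans (add_le_add ?_ ?_)
          · refine (hlip (k + 1 + 1) i _ _).trans (mul_le_mul_of_nonneg_left ?_ hL0)
            exact (norm_le_pi_norm (x (k + 1 + 1) - x (k + 1)) i).trans hxx
          · rw [norm_smul, Real.norm_eq_abs]
            refine mul_le_mul hll ?_ (norm_nonneg _) (by positivity)
            have h2 := (hprob.smooth i).lip (x (k + 1) i) (xt (k + 1))
            have h3 := norm_apply_sub_le u (x (k + 1)) (xt (k + 1)) i
            have h4 : Lf * ‖x (k + 1) i - xt (k + 1)‖ ≤ Lf * ((1 + M₀) * S) :=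
              mul_le_mul_of_nonneg_left (by linarith) hLf.le
            have h5 := norm_le_norm_add_norm_sub' (gradient (f i) (x (k + 1) i))
              (gradient (f i) (xt (k + 1)))
            linarith [hxtG (k + 1) i]
        have h6 : ‖d‖ ≤ L * (2 * X k + gam * cy * (P * S))
            + lam * I * (G₀ + Lf * ((1 + M₀) * S)) :=
          (pi_norm_le_iff_of_nonneg (by positivity)).2 hbound
        have h7 : lam * Lf * (1 + M₀) * (I * S) ≤ lam * Lf * (1 + M₀) * (P * S) := by gcongr
        have h8 : 0 ≤ L * 2 * (P * S + I) := by positivity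
        have h9 : 0 ≤ L * gam * cy * (X k + I) := by positivity
        have h10 : 0 ≤ lam * G₀ * (X k + P * S) := by positivity
        have h11 : 0 ≤ lam * Lf * (1 + M₀) * (X k + I) := by positivity
        rw [hcd]
        linarith
      have h1 : Y (k + 1) ≤ ρC * Y k + cC * ((1 + m) * ‖d‖) := by
        have h2 : Y (k + 1) = qC (mix AC (devY v (y (k + 1))) + devY v d) := by
          simp only [hY]; rw [hys, devY_mix hm hmix.C_col hv hvm]
        rw [h2]
        refine (hqCadd _ _).trans (add_le_add (hqCmix _) ((hqC2 _).trans ?_))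
        exact mul_le_mul_of_nonneg_left (norm_devY_le hm hvabs d) hcC
      have h4 : ρC * Y k ≤ ρ * Y k := mul_le_mul_of_nonneg_right hρC hy0
      have h5 : cC * ((1 + m) * ‖d‖) ≤ cC * ((1 + m) * (cd * (X k + P * S + I))) := by gcongr
      have h7 : cC * ((1 + m) * (cd * (X k + P * S + I))) = c2 * (X k + P * S + I) := by
        rw [hc2]; ring
      have h6 : c2 * (X k + P * S + I) ≤ c * (X k + P * S + I) :=
        mul_le_mul_of_nonneg_right (by rw [hc]; linarith) (by positivity)
      linarith
    · have hl0 : 0 ≤ l := (decay_pos hlam hΓ0 _).le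
      have hllam : l ≤ lam := by
        rw [hlU]
        exact mul_le_of_le_one_right hlam.le
          (Real.rpow_le_one_of_one_le_of_nonpos hs1 (by linarith))
      have hκ : ‖wavg u (x (k + 1)) - xt (k + 1)‖ ≤ Z k + c * I := by
        have : M₀ * I ≤ c * I := by
          refine mul_le_mul_of_nonneg_right ?_ hI0
          have : 0 ≤ (gam * L') ^ 2 / 2 := by positivity
          rw [hc, hc3]; linarith
        linarith
      have h1 := norm_wavg_step_sub_le hm hL0 (hlip (k + 1)) htrack hv0 hvle (hxt (k + 1)) hu0 hum
        (hγ.nonneg (k + 1)) hγle hgm0 hθ.le (hγ.lower (k + 1)) (c := l * μf) (L' := L')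
        (by positivity)
        (by
          have : l * μf ≤ lam * μf := mul_le_mul_of_nonneg_right hllam hμf.le
          have : 0 ≤ m * L := by positivity
          rw [hL']; linarith)
        (by
          have : 0 ≤ lam * μf := by positivity
          rw [hL']; linarith)
        (strongly_monotone_sum_local_map hprob hl0) hκ
      have h2 : Z (k + 1) = ‖wavg u (x (k + 1) - gy) - xt (k + 1)‖ := by
        simp only [hZ]; rw [hxs, wavg_mix_row hu]
      rw [h2]
      refine h1.trans (add_le_add (mul_le_mul_of_nonneg_right ?_ (by positivity)) ?_)
      · have h3 : θ * gm / m * (l * μf) = c₀ * U := by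
          rw [hgmP, hlU, hc₀, ← hUP]; ring
        have h4 : (gm * L') ^ 2 / 2 = (gam * L') ^ 2 / 2 * P ^ 2 := by rw [hgmP]; ring
        rw [h3, h4]
        have h5 : (gam * L') ^ 2 / 2 * P ^ 2 ≤ c * P ^ 2 :=
          mul_le_mul_of_nonneg_right (by rw [hc, hc3]; linarith) (sq_nonneg P)
        linarith
      · have h3 : m * L * gm * ‖devX u (x (k + 1))‖ ≤ m * L * gm * X k := by gcongr
        have h4 : gm * ‖devY v (y (k + 1))‖ ≤ gm * Y k := by gcongr
        have h5 : m * L * gm * X k + gm * Y k ≤ c4 * P * (X k + Y k) := by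
          have h6 : 0 ≤ gam * P * X k := by positivity
          have h7 : 0 ≤ m * L * gam * P * Y k := by positivity
          rw [hgmP, hc4]; linarith
        have h6 : c4 * P * (X k + Y k) ≤ c * P * (X k + Y k) := by
          refine mul_le_mul_of_nonneg_right (mul_le_mul_of_nonneg_right ?_ hP0) (by positivity)
          rw [hc]; linarith
        linarith
  have hfin := hrate X Y Z hX0 hY0 hZ0 (fun k => (hstep k).1) (fun k => (hstep k).2.1)
    (fun k => (hstep k).2.2)
  intro k
  obtain ⟨hx, hy, hz⟩ := hfin k
  have hΔ0 : 0 ≤ Δ₁ := Real.sqrt_nonneg _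
  have hΔZ : Z 0 ≤ Δ₁ := Real.le_sqrt_of_sq_le (by
    have := sq_nonneg (errX NR u (x 1)); have := sq_nonneg (errY NC v (y 1)); simp only [hZ]
    linarith)
  have hΔX : errX NR u (x 1) ≤ Δ₁ := Real.le_sqrt_of_sq_le (by
    have := sq_nonneg ‖wavg u (x 1) - xt 0‖; have := sq_nonneg (errY NC v (y 1)); linarith)
  have hΔY : errY NC v (y 1) ≤ Δ₁ := Real.le_sqrt_of_sq_le (by
    have := sq_nonneg ‖wavg u (x 1) - xt 0‖; have := sq_nonneg (errX NR u (x 1)); linarith)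
  have hX1 : X 0 ≤ cR * eR * Δ₁ := by
    have h1 : ‖devX u (x 1)‖ ≤ eR * errX NR u (x 1) := (heRx _).2
    calc X 0 ≤ cR * ‖devX u (x 1)‖ := hqR2 _
      _ ≤ cR * (eR * Δ₁) := by gcongr; exact h1.trans (by gcongr)
      _ = _ := by ring
  have hY1 : Y 0 ≤ cC * eC * Δ₁ := by
    have h1 : ‖devY v (y 1)‖ ≤ eC * errY NC v (y 1) := (heCx _).2
    calc Y 0 ≤ cC * ‖devY v (y 1)‖ := hqC2 _
      _ ≤ cC * (eC * Δ₁) := by gcongr; exact h1.trans (by gcongr)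
      _ = _ := by ring
  have hs : 0 < (k : ℝ) + (Γ + 1) := by positivity
  set Q := ((k : ℝ) + (Γ + 1)) ^ (-(1 - a - b)) with hQ
  have hQ0 : 0 ≤ Q := Real.rpow_nonneg hs.le _
  set T := K * (1 + cR * eR + cC * eC + 1) * (1 + Δ₁) * Q with hT
  have hT0 : 0 ≤ T := by positivity
  have hle : K * (1 + X 0 + Y 0 + Z 0) * Q ≤ T := by
    rw [hT, mul_assoc K _ (1 + Δ₁)]
    refine mul_le_mul_of_nonneg_right (mul_le_mul_of_nonneg_left ?_ hK.le) hQ0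
    have h1 : 0 ≤ cR * eR := by positivity
    have h2 : 0 ≤ cC * eC := by positivity
    linarith
  have hKT : (eR + eC + 1) * (K * (1 + cR * eR + cC * eC + 1)) * (1 + Δ₁) * Q
      = eR * T + eC * T + T := by rw [hT]; ring
  rw [hKT]
  have heRT : 0 ≤ eR * T := by positivity
  have heCT : 0 ≤ eC * T := by positivity
  refine ⟨?_, ?_, by linarith⟩
  · have h1 : errX NR u (x (k + 1)) ≤ eR * ‖devX u (x (k + 1))‖ := (heRx _).1
    have h2 : eR * ‖devX u (x (k + 1))‖ ≤ eR * T :=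
      mul_le_mul_of_nonneg_left ((hqR1 _).trans (hx.trans hle)) heR
    linarith
  · have h1 : errY NC v (y (k + 1)) ≤ eC * ‖devY v (y (k + 1))‖ := (heCx _).1
    have h2 : eC * ‖devY v (y (k + 1))‖ ≤ eC * T :=
      mul_le_mul_of_nonneg_left ((hqC1 _).trans (hy.trans hle)) heC
    linarith

end Algorithm

/-! ### The main theorem: choice of the constants. -/

theorem theorem1 {m n : ℕ}
    (f : Fin m → EuclideanSpace ℝ (Fin n) → ℝ)
    (F : Fin m → EuclideanSpace ℝ (Fin n) → EuclideanSpace ℝ (Fin n))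
    (μf Lf LF : ℝ) (hprob : ProblemAssumption f F μf Lf LF)
    (hne : (VISol Set.univ (sumMap F)).Nonempty)
    (R C : Matrix (Fin m) (Fin m) ℝ) (hmix : MixingAssumption R C)
    -- the Perron vectors of the mixing matrices
    (u v : Fin m → ℝ)
    (hu0 : ∀ i, 0 ≤ u i) (hu : Matrix.vecMul u R = u) (hum : ∑ i, u i = (m : ℝ))
    (hv0 : ∀ i, 0 ≤ v i) (hv : Matrix.mulVec C v = v) (hvm : ∑ i, v i = (m : ℝ))
    -- arbitrary norms on `ℝᵐ`
    (NR NC : Seminorm ℝ (Fin m → ℝ))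
    (hNR : ∀ w, NR w = 0 → w = 0) (hNC : ∀ w, NC w = 0 → w = 0)
    (δ : ℝ) (hδ : 0 < δ)
    (hδC : ∀ W : Matrix (Fin m) (Fin n) ℝ, colNorm NC W ≤ δ * colNorm l2 W)
    -- parameters of the update rules
    (gam lam Γ a b θ : ℝ) (hgam : 0 < gam) (hlam : 0 < lam) (hΓ : 1 ≤ Γ)
    (hb : 0 < b) (hba : b < a) (hab : a + b < 1) (hab' : 2 * a + 3 * b < 2) (hθ : 0 < θ) :
    ∃ (xs : EuclideanSpace ℝ (Fin n)) (xt : ℕ → EuclideanSpace ℝ (Fin n)) (M BF K : ℝ),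
      -- the unique optimal equilibrium and the Tikhonov trajectory
      optimalNE f F = {xs} ∧
      (∀ k, VISol Set.univ
        (fun x => sumMap F x + decay lam Γ b k • gradient (sumObj f) x) = {xt k}) ∧
      0 < M ∧ 0 < BF ∧ 1 ≤ K ∧
      (∀ k, ‖xt (k + 1) - xt k‖ ≤ M / μf * relDecr (decay lam Γ b) k) ∧
      (∀ k, LF * colNorm l2 (rowsMat fun _ : Fin m => xt k - xs) ≤ BF) ∧
      ∀ (γ : ℕ → Fin m → ℝ) (x0 : Fin m → EuclideanSpace ℝ (Fin n)),
        IsStepsize u v (decay gam Γ a) θ γ →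
        let x := fun k => (irPushPull f F R C (decay lam Γ b) γ x0 k).1
        let y := fun k => (irPushPull f F R C (decay lam Γ b) γ x0 k).2
        let Δ₁ := √(‖wavg u (x 1) - xt 0‖ ^ 2 + errX NR u (x 1) ^ 2 + errY NC v (y 1) ^ 2)
        let Θ := Theta R u v NR NC μf (LF + decay lam Γ b 0 * Lf) gam δ M BF (decay lam Γ b)
        let B := max (K * (Γ + 1) ^ (1 - a - b) * Δ₁) (4 * Θ / (μf * lam * gam * θ))
        (∀ k : ℕ, 1 ≤ k → errX NR u (x (k + 1)) ≤ B / ((k : ℝ) + Γ - 1) ^ (1 - a - b)) ∧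
        (∀ k : ℕ, 1 ≤ k → errY NC v (y (k + 1)) ≤ B / ((k : ℝ) + Γ - 1) ^ (1 - a - b)) ∧
        Filter.Tendsto (fun k => wavg u (x k)) Filter.atTop (nhds xs) := by
  have hm0 : 0 < m := by
    obtain ⟨r, -⟩ := hmix.roots
    exact r.pos
  have hmpos : (0 : ℝ) < m := by exact_mod_cast hm0
  have hΓ0 : 0 < Γ := by linarith
  have hμf := hprob.μf_pos
  have hLf := hprob.Lf_pos
  have hLF := hprob.LF_nonneg
  have hf : ∀ i, Differentiable ℝ (f i) := fun i =>
    (hprob.smooth i).contDiff.differentiable one_ne_zero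
  have hf' : Differentiable ℝ (sumObj f) := hprob.strong.contDiff.differentiable one_ne_zero
  have hl : ∀ k, 0 < decay lam Γ b k := decay_pos hlam hΓ0
  have hgradc : ∀ i, Continuous (gradient (f i)) := fun i =>
    (LipschitzWith.of_dist_le_mul (K := ⟨Lf, hLf.le⟩) fun x y => by
      rw [dist_eq_norm, dist_eq_norm]; exact (hprob.smooth i).lip x y).continuous
  have hFc : ∀ i, Continuous (F i) := fun i =>
    (LipschitzWith.of_dist_le_mul (K := ⟨LF, hLF⟩) fun x y => by
      rw [dist_eq_norm, dist_eq_norm]; exact hprob.lip i x y).continuous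
  have hΦc : Continuous (sumMap F) := continuous_finsetSum _ fun i _ => hFc i
  have hgc : Continuous (gradient (sumObj f)) := by
    rw [funext (gradient_sumObj hf)]
    exact continuous_finsetSum _ fun i _ => hgradc i
  have hex : ∀ k, ∃ z, ∑ i, (F i z + decay lam Γ b k • gradient (f i) z) = 0 := fun k => by
    refine exists_zero_of_strongly_monotone (L := m * (LF + lam * Lf)) (mul_pos (hl k) hμf)
      (strongly_monotone_sum_local_map hprob (hl k).le) fun z z' => ?_
    rw [← Finset.sum_sub_distrib]
    refine (norm_sum_le _ _).trans ?_
    refine (Finset.sum_le_sum fun i _ =>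
      lipschitz_local_map hprob hlam hΓ hb.le k i z z').trans ?_
    simp [mul_assoc]
  choose xt hxt using hex
  have hxt' : ∀ k, sumMap F (xt k) + decay lam Γ b k • gradient (sumObj f) (xt k) = 0 :=
    fun k => by rw [← sum_local_map hf]; exact hxt k
  obtain ⟨z₀, hz₀⟩ := hne
  obtain ⟨xs, hxs, hlim⟩ := exists_tendsto_of_regularized_zeros hμf hl (tendsto_decay lam Γ hb)
    hprob.mono hΦc hf' hgc hprob.strong.mono ⟨z₀, mem_VISol_univ.1 hz₀⟩ hxt'
  obtain ⟨D, hD⟩ : ∃ D : ℝ, ∀ k, ‖xt k - xs‖ ≤ D := by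
    obtain ⟨D, hD⟩ := (hlim.sub_const xs).norm.bddAbove_range
    exact ⟨D, fun k => hD ⟨k, rfl⟩⟩
  have hD0 : 0 ≤ D := (norm_nonneg _).trans (hD 0)
  -- Convergence of the trajectory makes it bounded, hence the local gradients along it are bounded
  -- too.
  set G₀ := ∑ i, ‖gradient (f i) xs‖ + Lf * D with hG₀
  have hG₀0 : 0 ≤ G₀ := by positivity
  have hxtG : ∀ k i, ‖gradient (f i) (xt k)‖ ≤ G₀ := fun k i => by
    have h1 := norm_le_norm_add_norm_sub' (gradient (f i) (xt k)) (gradient (f i) xs)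
    have h2 := (hprob.smooth i).lip (xt k) xs
    have h3 := mul_le_mul_of_nonneg_left (hD k) hLf.le
    have h4 := Finset.single_le_sum (f := fun i => ‖gradient (f i) xs‖)
      (fun _ _ => norm_nonneg _) (Finset.mem_univ i)
    rw [hG₀]; linarith
  have hxtM : ∀ k, ‖xt (k + 1) - xt k‖ ≤ m * G₀ / μf * relDecr (decay lam Γ b) k := fun k => by
    refine (norm_sub_le_of_regularized_zeros hμf (hl k) hprob.mono hprob.strong.mono (hxt' k)
      (hxt' (k + 1))).trans (mul_le_mul_of_nonneg_right ?_ (abs_nonneg _))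
    refine div_le_div_of_nonneg_right ?_ hμf.le
    rw [gradient_sumObj hf]
    refine (norm_sum_le _ _).trans ((Finset.sum_le_sum fun i _ => hxtG (k + 1) i).trans ?_)
    simp
  obtain ⟨K, hK, hrate⟩ := exists_uniform_rate hprob hmix hu0 hu hum hv0 hv hvm hNR hNC
    hgam hlam hΓ hb hba hab hθ (by positivity) hG₀0 hxt hxtM hxtG
  -- a large `M` makes the second term of the maximum dominate the constant part of the rate
  set q := μf * lam * gam * θ with hq
  have hq0 : 0 < q := by positivity
  set M := m * G₀ + K * q * μf + 1 with hM
  have hM0 : 0 < M := by positivity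
  refine ⟨xs, xt, M, LF * (√m * D) + 1, 2 * K + 1, ?_, fun k => ?_, hM0, by positivity,
    by linarith, fun k => ?_, fun k => ?_, fun γ x0 hγ => ?_⟩
  · rw [← hxs]
    ext z
    simp only [optimalNE, mem_VISol_univ, Set.mem_ofPred_eq]
  · refine Set.eq_singleton_iff_unique_mem.2 ⟨mem_VISol_univ.2 (hxt' k), fun z hz => ?_⟩
    refine eq_of_strongly_monotone_of_eq_zero (mul_pos (hl k) hμf)
      (strongly_monotone_sum_local_map hprob (hl k).le) ?_ (hxt k)
    rw [sum_local_map hf]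
    exact (mem_VISol_univ (G := fun x => sumMap F x + decay lam Γ b k • gradient (sumObj f) x)).1 hz
  · refine (hxtM k).trans (mul_le_mul_of_nonneg_right ?_ (abs_nonneg _))
    refine div_le_div_of_nonneg_right ?_ hμf.le
    have : 0 ≤ K * q * μf := by positivity
    rw [hM]; linarith
  · have h1 : colNorm l2 (rowsMat fun _ : Fin m => xt k - xs) = √m * ‖xt k - xs‖ := by
      rw [EuclideanSpace.norm_eq, ← Real.sqrt_mul (Nat.cast_nonneg m), colNorm, Finset.mul_sum]
      congr 1
      refine Finset.sum_congr rfl fun j _ => ?_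
      rw [l2, Real.sq_sqrt (Finset.sum_nonneg fun _ _ => sq_nonneg _)]
      simp [rowsMat]
    rw [h1]
    have h2 : LF * (√m * ‖xt k - xs‖) ≤ LF * (√m * D) := by
      have := hD k
      gcongr
    linarith
  · intro x y Δ₁ Θ B
    have hkey := hrate γ x0 hγ
    have hΔ0 : 0 ≤ Δ₁ := Real.sqrt_nonneg _
    have hΘ : K * q ≤ Θ := by
      have h1 : 1 ≤ √3 := Real.one_le_sqrt.2 (by norm_num)
      have h2 : K * q ≤ √3 * M / μf := by
        rw [le_div_iff₀ hμf]
        have : 0 ≤ m * G₀ := by positivity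
        have : M ≤ √3 * M := le_mul_of_one_le_left hM0.le h1
        linarith
      have h3 : 0 ≤ √3 * M / μf := by positivity
      exact h2.trans (le_mul_of_one_le_left h3
        (le_max_of_le_left (le_max_left _ _)))
    have hB1 : 2 * K * Δ₁ ≤ B := by
      refine le_max_of_le_left (mul_le_mul_of_nonneg_right ?_ hΔ0)
      have h1 : 1 ≤ (Γ + 1) ^ (1 - a - b) := Real.one_le_rpow (by linarith) (by linarith)
      have h2 : 2 * K + 1 ≤ (2 * K + 1) * (Γ + 1) ^ (1 - a - b) :=
        le_mul_of_one_le_right (by linarith) h1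
      linarith
    have hB2 : 2 * K ≤ B := by
      refine le_max_of_le_right ?_
      rw [le_div_iff₀ hq0]
      have : 0 < K * q := by positivity
      linarith
    -- The mean of the two preceding bounds, one from each branch of the maximum.
    have hBK : K * (1 + Δ₁) ≤ B := by linarith
    have hcomp : ∀ k : ℕ, 1 ≤ k → K * (1 + Δ₁) * ((k : ℝ) + (Γ + 1)) ^ (-(1 - a - b))
        ≤ B / ((k : ℝ) + Γ - 1) ^ (1 - a - b) := fun k hk => by
      have hk' : (1 : ℝ) ≤ k := by exact_mod_cast hk
      -- Here `1 ≤ k` matters: for `Γ = 1` and `k = 0` the base would vanish.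
      have h0 : 0 < (k : ℝ) + Γ - 1 := by linarith
      rw [Real.rpow_neg (by linarith), ← div_eq_mul_inv]
      refine div_le_div₀ (by linarith) hBK (Real.rpow_pos_of_pos h0 _) ?_
      exact Real.rpow_le_rpow h0.le (by linarith) (by linarith)
    refine ⟨fun k hk => (hkey k).1.trans (hcomp k hk), fun k hk => (hkey k).2.1.trans (hcomp k hk),
      ?_⟩
    rw [← tendsto_add_atTop_iff_nat 1]
    have h1 : Tendsto (fun k => wavg u (x (k + 1)) - xt k) atTop (𝓝 0) := by
      refine squeeze_zero_norm (fun k => (hkey k).2.2) ?_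
      have := (tendsto_natCast_add_rpow_neg (Γ + 1) (p := 1 - a - b) (by linarith)).const_mul
        (K * (1 + Δ₁))
      rwa [mul_zero] at this
    simpa using h1.add hlim
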